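/- **Lemma ($L^1_T$-vanishing of the initial field remainder).** Let $\omega(\xi)=|\xi|$ on $\mathbb{R}^3$, let $e^{-it\omega(-i\nabla)}$ be the free half-wave group on $L^2(\mathbb{R}^3)$ (the Fourier multiplier $e^{-it|\xi|}$), and let $\langle t\rangle=(1+t^2)^{1/2}$. Let $u_0\in W^{3,1}(\mathbb{R}^3;\mathbb{C})$. Then $u_0\in L^2(\mathbb{R}^3)$, and there is a constant $C_0\ge 0$, depending only on $u_0$, such that $$\|e^{-it\omega(-i\nabla)}u_0\|_{L^\infty(\mathbb{R}^3)}\le C_0\langle t\rangle^{-1}\qquad\text{for all } t\ge 0 .$$ Moreover, let $V\in C^\infty(\mathbb{R}^3;\mathbb{R})$ be a confining potential, $V(x)\ge c|x|-C$ for some $c,C>0$, let $\{\chi_k\}_{k\ge0}$ be an orthonormal basis of $L^2(\mathbb{R}^3)$ of eigenfunctions of $-\Delta+V$ with eigenvalues $E_k$, let $w\in L^1(\mathbb{R}^3;\mathbb{R})$, and, for every $\eta>0$, let $(\varphi_t)_{t\ge0}=(\varphi^\eta_t)_{t\ge 0}\subset L^2(\mathbb{R}^3)$ be a time-dependent boson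 wave function with $\|\varphi_t\|_{L^2}=1$ for all $t\ge0$. Define $$\mathrm{Rem}(t):=\eta\,\bigl(w*\mathrm{Re}\,(e^{-it\omega(-i\nabla)}u_0)\bigr)\varphi_t ,\qquad \mathrm{Rem}_k(t):=e^{itE_k}\langle\chi_k,\mathrm{Rem}(t)\rangle_{L^2}.$$ Then $\mathrm{Rem}(t)\in L^2(\mathbb{R}^3)$ for all $\eta>0$, $t\ge 0$, and with $C_1:=C_0\|w\|_{L^1}$, for every $T>0$ and every $\eta>0$, $$\int_0^T\Bigl\|\frac1{\eta^2}\bigl(\mathrm{Rem}_k(s/\eta^2)\bigr)_{k\ge 0}\Bigr\|_{\ell^2(\mathbb{C})}ds\;\le\; C_1\,\eta\,\ln\!\Bigl(\frac{T+\sqrt{\eta^4+T^2}}{\eta^2}\Bigr),$$ and for every fixed $T>0$ the right-hand side, hence also the left-hand side, tends to $0$ as $\eta\to0^+$. -/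

import Mathlib

open MeasureTheory Filter Topology
open scoped ENNReal ContDiff FourierTransform Convolution

noncomputable section

namespace InitialField

/-- Physical space `ℝ³` with the Euclidean norm. -/
abbrev R3 : Type := EuclideanSpace ℝ (Fin 3)

/-- The complex Hilbert space `L²(ℝ³; ℂ)` (Lebesgue measure). -/
abbrev L2 : Type := Lp (α := R3) ℂ 2 volume

/-- Test functions: `ψ ∈ C_c^∞(ℝ³; ℂ)`. -/
def IsTest (ψ : R3 → ℂ) : Prop := ContDiff ℝ ∞ ψ ∧ HasCompactSupport ψ

/-- `g` is the weak partial derivative `∂ᵢ f` on `ℝ³`. -/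
def HasWeakPartial (i : Fin 3) (f g : R3 → ℂ) : Prop :=
  ∀ ψ : R3 → ℂ, IsTest ψ →
    ∫ x, f x * fderiv ℝ ψ x (EuclideanSpace.single i (1 : ℝ)) = -∫ x, g x * ψ x

/-- The Sobolev space `W^{m,1}(ℝ³; ℂ)`: all weak derivatives up to order `m` exist and are in
`L¹`. -/
def MemW1 : ℕ → (R3 → ℂ) → Prop
  | 0, f => Integrable f
  | m + 1, f => Integrable f ∧ ∀ i : Fin 3, ∃ g : R3 → ℂ, HasWeakPartial i f g ∧ MemW1 m g

/-- The symbol of `e^{-itω(-i∇)}`, `ω(ξ) = |ξ|`. Mathlib's Fourier transform has the kernel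
`e^{-2πi x·ξ}`, so that `-i∇` corresponds to `2πξ`. -/
def halfWaveSymbol (t : ℝ) (ξ : R3) : ℂ :=
  Complex.exp (-(Complex.I * (t * (2 * Real.pi * ‖ξ‖) : ℝ)))

theorem norm_halfWaveSymbol (t : ℝ) (ξ : R3) : ‖halfWaveSymbol t ξ‖ = 1 := by
  unfold halfWaveSymbol
  rw [← mul_neg, ← Complex.ofReal_neg, Complex.norm_exp_I_mul_ofReal]

theorem continuous_halfWaveSymbol (t : ℝ) : Continuous (halfWaveSymbol t) := by
  unfold halfWaveSymbol
  fun_prop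

theorem memLp_halfWaveSymbol_mul (t : ℝ) (f : L2) :
    MemLp (fun ξ => halfWaveSymbol t ξ * f ξ) 2 (volume : Measure R3) := by
  refine (Lp.memLp f).of_le
    ((continuous_halfWaveSymbol t).aestronglyMeasurable.mul (Lp.aestronglyMeasurable f)) ?_
  filter_upwards with ξ
  rw [norm_mul, norm_halfWaveSymbol, one_mul]

/-- The free half-wave propagator `e^{-itω(-i∇)}` on `L²(ℝ³)`, `ω(ξ) = |ξ|`, as a Fourier
multiplier. -/
def halfWave (t : ℝ) (u : L2) : L2 :=
  𝓕⁻ ((memLp_halfWaveSymbol_mul t (𝓕 u : L2)).toLp _)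

/-- Confining potentials: smooth and coercive, `V(x) ≥ c|x| - C` with `c, C > 0`. -/
def IsConfining (V : R3 → ℝ) : Prop :=
  ContDiff ℝ ∞ V ∧ ∃ c > 0, ∃ C > 0, ∀ x, c * ‖x‖ - C ≤ V x

/-- `χ` is an orthonormal basis of `L²(ℝ³)` made of eigenfunctions of `-Δ + V`, with
eigenvalues `E k`. For a confining `V` the operator `-Δ + V` is essentially self-adjoint on
`C_c^∞`, hence equal to the adjoint of its restriction to `C_c^∞`: an element of `L²` is an
eigenfunction if and only if it satisfies the eigenvalue equation against all test functions. -/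
def IsEigenbasis (V : R3 → ℝ) (E : ℕ → ℝ) (χ : HilbertBasis ℕ ℂ L2) : Prop :=
  ∀ k : ℕ, ∀ ψ : R3 → ℂ, IsTest ψ →
    ∫ x, χ k x * (-(Laplacian.laplacian ψ x) + (V x : ℂ) * ψ x) = (E k : ℂ) * ∫ x, χ k x * ψ x

/-- The initial field remainder
`Rem(t) = η (w * Re(e^{-itω(-i∇)} u₀)) φ_t`, where `φt` is the boson state at time `t`. -/
def remainder (η : ℝ) (w : R3 → ℝ) (u₀ : L2) (φt : L2) (t : ℝ) : R3 → ℂ := fun x =>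
  ((η * (w ⋆[ContinuousLinearMap.mul ℝ ℝ, volume] (fun y => (halfWave t u₀ y).re)) x : ℝ) : ℂ)
    * φt x

/-- The modal coefficient `Rem_k(t) = e^{itE_k} ⟨χ_k, Rem(t)⟩`. -/
def remainderMode (χk : L2) (Ek : ℝ) (η : ℝ) (w : R3 → ℝ) (u₀ : L2) (φt : L2) (t : ℝ) : ℂ :=
  Complex.exp (Complex.I * (t * Ek : ℝ)) *
    ∫ x, (starRingEnd ℂ) (χk x) * remainder η w u₀ φt t x

/-- `∫₀ᵀ ‖ η⁻² (Rem_k(s/η²))_k ‖_{ℓ²} ds`, as an element of `[0,∞]`. -/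
def scaledRemainderIntegral (χ : HilbertBasis ℕ ℂ L2) (E : ℕ → ℝ) (η : ℝ) (w : R3 → ℝ)
    (u₀ : L2) (φ : ℝ → L2) (T : ℝ) : ℝ≥0∞ :=
  ∫⁻ s in Set.Icc 0 T,
    eLpNorm (fun k : ℕ => (1 / (η : ℂ) ^ 2) *
      remainderMode (χ k) (E k) η w u₀ (φ (s / η ^ 2)) (s / η ^ 2)) 2 Measure.count

end InitialField

end

open scoped SchwartzMap

noncomputable section

namespace InitialField

/-! The heart is the dispersive bound. Write `m = 2π|ξ|` and regularise `e^{-itm}` to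
`e^{-(ε+it)m}`. For `Re z > 0` the symbol `e^{-zm}/m` has the explicit kernel `1/(2π²(z² + |x|²))`
(`fourierInv_greenSymbol`). At `z = ε + s + it` this kernel and its gradient decay in `t`, but they
blow up on the light cone `|x| = t` as `ε + s → 0`.

The blow-up is averaged out with a polynomial weight `g` on `(0,1]`. Repeated integration by parts
(`integral_cutoff`) gives `1 = m³ ∫ g e^{-sm} ds - m⁻¹ ∫ g'''' e^{-sm} ds`. Multiplied by
`e^{-(ε+it)m} û`, the second term is an average of Green symbols acting on `u`. In the first, `m³ =
m⁻¹ m⁴`, and `m⁴ û` is the transform of the divergence of `∇Δu`; the divergence is put on the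
kernel, so three derivatives of `u` in `L¹` suffice. Both `g` and `g''''` are `O(s²)`, which cancels
the singularity. This gives `norm_fourierInv_damped_le`, uniform in `ε`, and `ε → 0` is taken in
`L²`.

The rest is soft: Young's inequality for `w * Re(...)`, Bessel's inequality for the modes, and
`arsinh` as the primitive of `⟨s⟩⁻¹`. The powers `η⁻² · η · η²` leave `η` times a logarithm of order
`log(1/η)`. -/

/-! ### Fourier integrals of `L¹` functions versus the Fourier transform on `L²`. -/

theorem fourierInv_toLp_ae_eq {F h : R3 → ℂ} (hF : MemLp F 2 volume)
    (hh : LocallyIntegrable h volume)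
    (H : ∀ g : 𝓢(R3, ℂ), ∫ x, g x * h x = ∫ ξ, (𝓕⁻ (g : R3 → ℂ)) ξ * F ξ) :
    (𝓕⁻ (hF.toLp F) : L2) =ᵐ[volume] h := by
  refine ae_eq_of_integral_contDiff_smul_eq
    ((Lp.memLp _).locallyIntegrable (by norm_num)) hh fun g hg hgs => ?_
  have hg' : ContDiff ℝ ∞ (fun x => (g x : ℂ)) := Complex.ofRealCLM.contDiff.comp hg
  have hgs' : HasCompactSupport (fun x => (g x : ℂ)) := hgs.comp_left Complex.ofReal_zero
  let G : 𝓢(R3, ℂ) := hgs'.toSchwartzMap hg'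
  have hG : ∀ x, G x = (g x : ℂ) := fun x => rfl
  -- The `L²` transform is moved onto the Schwartz function `G` through tempered distributions, and
  -- there it is an ordinary integral.
  have h1 := Lp.toTemperedDistribution_apply (𝓕⁻ (hF.toLp F) : L2) G
  rw [← Lp.fourierInv_toTemperedDistribution_eq, TemperedDistribution.fourierInv_apply,
    Lp.toTemperedDistribution_apply] at h1
  have h2 := H G
  simp only [Complex.real_smul]
  simp only [hG, smul_eq_mul] at h1 h2
  rw [← h1, h2]
  refine integral_congr_ae ?_
  filter_upwards [hF.coeFn_toLp] with ξ hξ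
  rw [hξ, SchwartzMap.fourierInv_coe]

theorem integral_mul_fourier_eq {f g : R3 → ℂ} (hf : Integrable f) (hg : Integrable g) :
    ∫ ξ, 𝓕 f ξ * g ξ = ∫ x, f x * 𝓕 g x := by
  have := VectorFourier.integral_fourierIntegral_smul_eq_flip (μ := (volume : Measure R3))
    (ν := (volume : Measure R3)) (L := innerₗ R3) Real.continuous_fourierChar
    continuous_inner hf hg
  rw [flip_innerₗ] at this
  exact this

theorem integral_mul_fourierInv_eq {f g : R3 → ℂ} (hf : Integrable f) (hg : Integrable g) :
    ∫ ξ, 𝓕⁻ f ξ * g ξ = ∫ x, f x * 𝓕⁻ g x := by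
  have h := integral_mul_fourier_eq (hf.comp_neg) hg
  simp only [Real.fourierInv_eq_fourier_comp_neg f]
  rw [h, ← integral_neg_eq_self]
  simp [Real.fourierInv_eq_fourier_neg]

theorem continuous_fourier {f : R3 → ℂ} (hf : Integrable f) : Continuous (𝓕 f) :=
  VectorFourier.fourierIntegral_continuous Real.continuous_fourierChar continuous_inner hf

theorem continuous_fourierInv {f : R3 → ℂ} (hf : Integrable f) : Continuous (𝓕⁻ f) := by
  have : 𝓕⁻ f = fun x => 𝓕 f (-x) := funext fun x => Real.fourierInv_eq_fourier_neg f x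
  rw [this]
  exact (continuous_fourier hf).comp continuous_neg

theorem norm_fourier_le {f : R3 → ℂ} (ξ : R3) : ‖𝓕 f ξ‖ ≤ ∫ x, ‖f x‖ :=
  VectorFourier.norm_fourierIntegral_le_integral_norm _ _ _ f ξ

theorem fourierInv_toLp_ae_eq_of_integrable {F : R3 → ℂ} (hF : MemLp F 2 volume)
    (hF1 : Integrable F) : (𝓕⁻ (hF.toLp F) : L2) =ᵐ[volume] 𝓕⁻ F :=
  fourierInv_toLp_ae_eq hF (continuous_fourierInv hF1).locallyIntegrable fun g =>
    (integral_mul_fourierInv_eq g.integrable hF1).symm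

theorem fourierInv_fourier_toLp_ae_eq {f : R3 → ℂ} (hf : Integrable f)
    (hF : MemLp (𝓕 f) 2 volume) : (𝓕⁻ (hF.toLp (𝓕 f)) : L2) =ᵐ[volume] f :=
  fourierInv_toLp_ae_eq hF hf.locallyIntegrable fun g => by
    have hg : Integrable (𝓕⁻ (g : R3 → ℂ)) := by
      rw [← SchwartzMap.fourierInv_coe]
      exact (𝓕⁻ g).integrable
    have h := integral_mul_fourier_eq hf hg
    have h2 : 𝓕 (𝓕⁻ (g : R3 → ℂ)) = g := g.continuous.fourier_fourierInv_eq g.integrable (by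
      rw [← SchwartzMap.fourier_coe]
      exact (𝓕 g).integrable)
    rw [h2] at h
    simp only [mul_comm] at h ⊢
    exact h.symm

/-- Plancherel cannot be applied to `f`, not yet known to be in `L²`. Instead `f` is recognised as
the `L²` inverse transform of `𝓕 f`. -/
theorem memLp_two_of_fourier {f : R3 → ℂ} (hf : Integrable f)
    (hF : MemLp (𝓕 f) 2 volume) : MemLp f 2 volume :=
  (memLp_congr_ae (fourierInv_fourier_toLp_ae_eq hf hF)).1 (Lp.memLp _)

theorem fourier_toLp_eq {f : R3 → ℂ} (hf : Integrable f) (hf2 : MemLp f 2 volume)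
    (hF : MemLp (𝓕 f) 2 volume) : (𝓕 (hf2.toLp f) : L2) = hF.toLp (𝓕 f) := by
  have : hf2.toLp f = 𝓕⁻ (hF.toLp (𝓕 f)) :=
    Lp.ext (hf2.coeFn_toLp.trans (fourierInv_fourier_toLp_ae_eq hf hF).symm)
  rw [this, FourierTransform.fourier_fourierInv_eq]

/-- The inverse transform of `κ * 𝓕 u` is the convolution of `u` and `𝓕⁻ κ`. -/
theorem fourierInv_mul_fourier {u κ : R3 → ℂ} (hu : Integrable u) (hκ : Integrable κ) (x : R3) :
    𝓕⁻ (fun ξ => κ ξ * 𝓕 u ξ) x = ∫ y, u y * 𝓕⁻ κ (x - y) := by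
  have hg : Integrable (fun ξ : R3 => (Real.fourierChar (inner ℝ ξ x)) • κ ξ) := by
    have := (Real.fourierIntegral_convergent_iff (f := κ) (μ := (volume : Measure R3)) (-x)).2 hκ
    simpa using this
  have h := integral_mul_fourier_eq hu hg
  rw [Real.fourierInv_eq]
  convert h using 1
  · refine integral_congr_ae (.of_forall fun ξ => ?_)
    simp only [Circle.smul_def, smul_eq_mul]
    ring
  · refine integral_congr_ae (.of_forall fun y => ?_)
    simp only [Real.fourierInv_eq, Real.fourier_eq]
    congr 1
    refine integral_congr_ae (.of_forall fun ξ => ?_)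
    simp only [smul_smul, ← AddChar.map_add_eq_mul, inner_sub_right]
    congr 2
    ring

theorem norm_fourierInv_mul_fourier_le {u κ : R3 → ℂ} (hu : Integrable u) (hκ : Integrable κ)
    {B : ℝ} (hB : ∀ y, ‖𝓕⁻ κ y‖ ≤ B) (x : R3) :
    ‖𝓕⁻ (fun ξ => κ ξ * 𝓕 u ξ) x‖ ≤ B * ∫ y, ‖u y‖ := by
  rw [fourierInv_mul_fourier hu hκ, ← integral_const_mul]
  refine norm_integral_le_of_norm_le (hu.norm.const_mul B) (.of_forall fun y => ?_)
  rw [norm_mul, mul_comm]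
  gcongr
  exact hB _

/-! ### Weak derivatives on the Fourier side. -/

/-- The plane wave `x ↦ e^{-2πi x·ξ}`. -/
def planeWave (ξ x : R3) : ℂ := Complex.exp ((-2 * Real.pi * inner ℝ x ξ : ℝ) * Complex.I)

theorem norm_planeWave (ξ x : R3) : ‖planeWave ξ x‖ = 1 := Complex.norm_exp_ofReal_mul_I _

theorem contDiff_planeWave (ξ : R3) : ContDiff ℝ ∞ (planeWave ξ) := by
  unfold planeWave
  refine ContDiff.cexp (ContDiff.mul (Complex.ofRealCLM.contDiff.comp ?_) contDiff_const)
  exact contDiff_const.mul (contDiff_id.inner ℝ contDiff_const)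

theorem fourier_eq_integral_planeWave (f : R3 → ℂ) (ξ : R3) :
    𝓕 f ξ = ∫ x, f x * planeWave ξ x := by
  rw [Real.fourier_eq']
  refine integral_congr_ae (.of_forall fun x => ?_)
  simp only [planeWave, smul_eq_mul]
  rw [mul_comm]

theorem fderiv_planeWave_apply (ξ x : R3) (i : Fin 3) :
    fderiv ℝ (planeWave ξ) x (EuclideanSpace.single i (1 : ℝ))
      = -(2 * Real.pi * Complex.I * ξ i) * planeWave ξ x := by
  have h1 : HasFDerivAt (fun x : R3 => inner ℝ x ξ) (innerSL ℝ ξ) x := by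
    have := (innerSL ℝ ξ).hasFDerivAt (x := x)
    refine this.congr_of_eventuallyEq (.of_forall fun y => ?_)
    simp [real_inner_comm]
  have h2 := ((Complex.ofRealCLM.hasFDerivAt.comp x (h1.const_mul (-2 * Real.pi))).mul_const
    Complex.I).cexp
  have h3 : HasFDerivAt (planeWave ξ) _ x := h2
  rw [h3.fderiv]
  simp [planeWave, EuclideanSpace.inner_single_right]
  ring

/-- A plane wave is not a test function, so it is cut off at radius of order `n`. The derivative
that falls on the cutoff carries the factor `c n → 0`, and dominated convergence removes the cutoff
because `f` and `g` are integrable. -/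
theorem fourier_hasWeakPartial {i : Fin 3} {f g : R3 → ℂ} (hf : Integrable f)
    (hg : Integrable g) (h : HasWeakPartial i f g) (ξ : R3) :
    𝓕 g ξ = 2 * Real.pi * Complex.I * ξ i * 𝓕 f ξ := by
  let χ : ContDiffBump (0 : R3) := ⟨1, 2, by norm_num, by norm_num⟩
  have hχ : ContDiff ℝ ∞ (χ : R3 → ℝ) := χ.contDiff
  set e : R3 := EuclideanSpace.single i (1 : ℝ) with he
  set c : ℕ → ℝ := fun n => 1 / ((n : ℝ) + 1) with hc
  have hc0 : ∀ n, c n ≠ 0 := fun n => by positivity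
  have hc1 : ∀ n, |c n| ≤ 1 := fun n => by
    rw [abs_of_nonneg (by positivity)]
    exact (div_le_one (by positivity)).2 (by linarith [n.cast_nonneg (α := ℝ)])
  have hclim : Tendsto c atTop (𝓝 0) := tendsto_one_div_add_atTop_nhds_zero_nat
  set ψ : ℕ → R3 → ℂ := fun n x => (χ (c n • x) : ℂ) * planeWave ξ x with hψ
  obtain ⟨D, hD⟩ : ∃ D, ∀ x, ‖fderiv ℝ (χ : R3 → ℝ) x‖ ≤ D :=
    (χ.hasCompactSupport.fderiv ℝ).exists_bound_of_continuous (hχ.continuous_fderiv (by simp))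
  have hcut : ∀ n, ContDiff ℝ ∞ fun x : R3 => ((χ (c n • x) : ℝ) : ℂ) := fun n =>
    Complex.ofRealCLM.contDiff.comp (hχ.comp (contDiff_const_smul (c n)))
  have htest : ∀ n, IsTest (ψ n) := fun n => by
    refine ⟨(hcut n).mul (contDiff_planeWave ξ), HasCompactSupport.mul_right ?_⟩
    exact (χ.hasCompactSupport.comp_smul (hc0 n)).comp_left Complex.ofReal_zero
  have hder : ∀ n x, fderiv ℝ (ψ n) x e = ((c n * fderiv ℝ χ (c n • x) e : ℝ) : ℂ) * planeWave ξ x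
      + (χ (c n • x) : ℂ) * (-(2 * Real.pi * Complex.I * ξ i) * planeWave ξ x) := by
    intro n x
    have h1 : HasFDerivAt (fun x : R3 => (χ (c n • x) : ℂ)) _ x :=
      Complex.ofRealCLM.hasFDerivAt.comp x
        (((hχ.differentiable (by simp)) (c n • x)).hasFDerivAt.comp x
          ((hasFDerivAt_id x).const_smul (c n)))
    have h2 := ((contDiff_planeWave ξ).differentiable (by simp) x).hasFDerivAt
    have h3 : HasFDerivAt (ψ n) _ x := h1.mul h2
    rw [h3.fderiv, ← fderiv_planeWave_apply]
    simp [he]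
    ring
  have hw : Continuous (planeWave ξ) := (contDiff_planeWave ξ).continuous
  have hχ0 : χ (0 : R3) = 1 := χ.one_of_mem_closedBall (by simp [χ])
  have hχx : ∀ x : R3, Tendsto (fun n => ((χ (c n • x) : ℝ) : ℂ)) atTop (𝓝 1) := fun x => by
    have h1 : Tendsto (fun n => c n • x) atTop (𝓝 0) := by simpa using hclim.smul_const x
    have h2 := (hχ.continuous.tendsto 0).comp h1
    rw [hχ0] at h2
    rw [← Complex.ofReal_one]
    exact (Complex.continuous_ofReal.tendsto 1).comp h2
  have hχ1 : ∀ x : R3, ‖((χ x : ℝ) : ℂ)‖ ≤ 1 := fun x => by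
    rw [Complex.norm_real, Real.norm_of_nonneg χ.nonneg]
    exact χ.le_one
  have hlimg : Tendsto (fun n => ∫ x, g x * ψ n x) atTop (𝓝 (∫ x, g x * planeWave ξ x)) := by
    refine tendsto_integral_of_dominated_convergence (fun x => ‖g x‖)
      (fun n => hg.1.mul (htest n).1.continuous.aestronglyMeasurable) hg.norm
      (fun n => .of_forall fun x => ?_) (.of_forall fun x => ?_)
    · rw [norm_mul, norm_mul, norm_planeWave, mul_one]
      exact mul_le_of_le_one_right (norm_nonneg _) (hχ1 _)
    · simpa using ((hχx x).mul_const (planeWave ξ x)).const_mul (g x)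
  have hlimf : Tendsto (fun n => ∫ x, f x * fderiv ℝ (ψ n) x e) atTop
      (𝓝 (∫ x, f x * (-(2 * Real.pi * Complex.I * ξ i) * planeWave ξ x))) := by
    set K : ℂ := -(2 * Real.pi * Complex.I * ξ i)
    refine tendsto_integral_of_dominated_convergence (fun x => ‖f x‖ * (D * ‖e‖ + ‖K‖))
      (fun n => hf.1.mul ?_) (hf.norm.mul_const _)
      (fun n => .of_forall fun x => ?_) (.of_forall fun x => ?_)
    · exact (((htest n).1.continuous_fderiv (by simp)).clm_apply
        continuous_const).aestronglyMeasurable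
    · rw [norm_mul, hder]
      gcongr
      refine (norm_add_le _ _).trans (add_le_add ?_ ?_)
      · rw [norm_mul, norm_planeWave, mul_one, Complex.norm_real, norm_mul]
        have := (fderiv ℝ χ (c n • x)).le_opNorm e
        calc ‖c n‖ * ‖fderiv ℝ χ (c n • x) e‖ ≤ 1 * (D * ‖e‖) := by
              gcongr
              · exact hc1 n
              · exact this.trans (by gcongr; exact hD _)
          _ = _ := one_mul _
      · rw [norm_mul, norm_mul, norm_planeWave, mul_one]
        exact mul_le_of_le_one_left (norm_nonneg _) (hχ1 _)
    · have h1 : Tendsto (fun n => ((c n * fderiv ℝ χ (c n • x) e : ℝ) : ℂ)) atTop (𝓝 0) := by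
        have h1 : Tendsto (fun n => c n • x) atTop (𝓝 0) := by simpa using hclim.smul_const x
        have h2 := (((hχ.continuous_fderiv (by simp)).clm_apply
          (continuous_const (y := e))).tendsto 0).comp h1
        have h3 := hclim.mul h2
        rw [zero_mul] at h3
        rw [← Complex.ofReal_zero]
        exact (Complex.continuous_ofReal.tendsto 0).comp h3
      simp only [hder]
      simpa using ((h1.mul_const (planeWave ξ x)).add
        ((hχx x).mul_const (K * planeWave ξ x))).const_mul (f x)
  have hlim := tendsto_nhds_unique hlimf
    ((hlimg.neg).congr fun n => (h (ψ n) (htest n)).symm)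
  rw [fourier_eq_integral_planeWave, fourier_eq_integral_planeWave f, ← neg_inj, ← hlim,
    ← integral_const_mul, ← integral_neg]
  refine integral_congr_ae (.of_forall fun x => ?_)
  simp only
  ring

/-! ### Consequences of `W^{3,1}` for the transform of `u`. -/

/-- The symbol `2π|ξ|` of `ω(-i∇)`. -/
def freq (ξ : R3) : ℝ := 2 * Real.pi * ‖ξ‖

theorem freq_nonneg (ξ : R3) : 0 ≤ freq ξ := by unfold freq; positivity

theorem freq_pos {ξ : R3} (h : ξ ≠ 0) : 0 < freq ξ := by
  have := norm_pos_iff.2 h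
  unfold freq; positivity

theorem sum_sq_eq_freq (ξ : R3) :
    ∑ i, (2 * Real.pi * Complex.I * ξ i) ^ 2 = -((freq ξ : ℂ) ^ 2) := by
  have h := EuclideanSpace.real_norm_sq_eq ξ
  have : (freq ξ : ℂ) ^ 2 = ((2 * Real.pi) ^ 2 * ∑ i, ξ i ^ 2 : ℝ) := by
    rw [← h, freq]; push_cast; ring
  rw [this]
  push_cast
  rw [Finset.mul_sum, ← Finset.sum_neg_distrib]
  refine Finset.sum_congr rfl fun i _ => ?_
  rw [mul_pow, mul_pow, Complex.I_sq]
  ring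

/-- The three components of `∇Δu` are integrable when `u ∈ W^{3,1}`. -/
theorem exists_grad_laplacian {u : R3 → ℂ} (hu : MemW1 3 u) :
    Integrable u ∧ ∃ v : Fin 3 → R3 → ℂ, (∀ j, Integrable (v j)) ∧
      ∀ j ξ, 𝓕 (v j) ξ = -((freq ξ : ℂ) ^ 2) * (2 * Real.pi * Complex.I * ξ j) * 𝓕 u ξ := by
  obtain ⟨hu0, h1⟩ := hu
  refine ⟨hu0, ?_⟩
  choose g hg hgm using h1
  have hg0 : ∀ i, Integrable (g i) := fun i => (hgm i).1
  have h2 : ∀ i, ∃ k, HasWeakPartial i (g i) k ∧ MemW1 1 k := fun i => (hgm i).2 i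
  choose k hk hkm using h2
  have hk0 : ∀ i, Integrable (k i) := fun i => (hkm i).1
  have h3 : ∀ i j, ∃ l, HasWeakPartial j (k i) l ∧ MemW1 0 l := fun i j => (hkm i).2 j
  choose l hl hlm using h3
  have hl0 : ∀ i j, Integrable (l i j) := fun i j => hlm i j
  refine ⟨fun j => ∑ i, l i j, fun j => integrable_finsetSum' _ fun i _ => hl0 i j,
    fun j ξ => ?_⟩
  have h4 : 𝓕 (∑ i, l i j) ξ = ∑ i, 𝓕 (l i j) ξ := by
    simp only [fourier_eq_integral_planeWave, Finset.sum_apply, Finset.sum_mul]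
    refine integral_finsetSum _ fun i _ => ?_
    refine (hl0 i j).mul_bdd (c := 1) (contDiff_planeWave ξ).continuous.aestronglyMeasurable
      (.of_forall fun x => (norm_planeWave ξ x).le)
  rw [h4, ← sum_sq_eq_freq, Finset.sum_mul, Finset.sum_mul]
  refine Finset.sum_congr rfl fun i _ => ?_
  rw [fourier_hasWeakPartial (hk0 i) (hl0 i j) (hl i j),
    fourier_hasWeakPartial (hg0 i) (hk0 i) (hk i),
    fourier_hasWeakPartial hu0 (hg0 i) (hg i)]
  ring

/-- This is `div ∇Δu = Δ²u` in Fourier variables, used without a fourth derivative of `u`: the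
factor `2πiξⱼ` will later be absorbed by the kernel. -/
theorem sum_mul_fourier_grad_laplacian {u : R3 → ℂ} {v : Fin 3 → R3 → ℂ}
    (hv : ∀ j ξ, 𝓕 (v j) ξ = -((freq ξ : ℂ) ^ 2) * (2 * Real.pi * Complex.I * ξ j) * 𝓕 u ξ)
    (ξ : R3) : ∑ j, (2 * Real.pi * Complex.I * ξ j) * 𝓕 (v j) ξ = (freq ξ : ℂ) ^ 4 * 𝓕 u ξ := by
  have : (freq ξ : ℂ) ^ 4 * 𝓕 u ξ = -((freq ξ : ℂ) ^ 2) * -((freq ξ : ℂ) ^ 2) * 𝓕 u ξ := by ring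
  rw [this, ← sum_sq_eq_freq, Finset.mul_sum, Finset.sum_mul, sum_sq_eq_freq]
  refine Finset.sum_congr rfl fun j _ => ?_
  rw [hv]
  ring

theorem norm_coord_le_freq (ξ : R3) (j : Fin 3) : ‖2 * Real.pi * Complex.I * ξ j‖ ≤ freq ξ := by
  have := PiLp.norm_apply_le ξ j
  simp only [norm_mul, Complex.norm_I, mul_one, Complex.norm_real, Complex.norm_ofNat, freq]
  rw [Real.norm_of_nonneg Real.pi_pos.le]
  gcongr

/-- Three integrable derivatives give `|û| = O((1 + |ξ|)⁻³)`, and the square decays with exponent `6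
> 3`. -/
theorem memLp_fourier_of_memW1 {u : R3 → ℂ} (hu : MemW1 3 u) : MemLp (𝓕 u) 2 volume := by
  obtain ⟨hu0, v, hv0, hv⟩ := exists_grad_laplacian hu
  set A : ℝ := ∫ x, ‖u x‖
  set B : ℝ := ∑ j, ∫ x, ‖v j x‖
  have hA : 0 ≤ A := integral_nonneg fun _ => norm_nonneg _
  have hB : 0 ≤ B := Finset.sum_nonneg fun _ _ => integral_nonneg fun _ => norm_nonneg _
  have hcub : ∀ ξ, ‖ξ‖ ^ 3 * ‖𝓕 u ξ‖ ≤ B := by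
    intro ξ
    rcases eq_or_ne ξ 0 with rfl | h0
    · simpa using hB
    have hm := freq_pos h0
    have hr := norm_pos_iff.2 h0
    have h1 : freq ξ ^ 4 * ‖𝓕 u ξ‖ ≤ freq ξ * B := by
      have := congrArg norm (sum_mul_fourier_grad_laplacian hv ξ)
      rw [norm_mul, norm_pow, Complex.norm_real, Real.norm_of_nonneg hm.le] at this
      rw [← this, Finset.mul_sum]
      refine norm_sum_le_of_le _ fun j _ => ?_
      rw [norm_mul]
      gcongr
      · exact norm_coord_le_freq ξ j
      · exact norm_fourier_le ξ
    have h2 : freq ξ ^ 3 * ‖𝓕 u ξ‖ ≤ B := by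
      refine le_of_mul_le_mul_left ?_ hm
      linarith [h1, show freq ξ * (freq ξ ^ 3 * ‖𝓕 u ξ‖) = freq ξ ^ 4 * ‖𝓕 u ξ‖ by ring]
    have h3 : ‖ξ‖ ≤ freq ξ := by
      unfold freq
      nlinarith [Real.pi_gt_three]
    exact le_trans (by gcongr) h2
  have hbd : ∀ ξ, ‖𝓕 u ξ‖ ^ 2 ≤ (8 * (A + B)) ^ 2 * (1 + ‖ξ‖) ^ (-6 : ℝ) := by
    intro ξ
    have h1 : (1 + ‖ξ‖) ^ 3 * ‖𝓕 u ξ‖ ≤ 8 * (A + B) := by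
      have ha : ‖𝓕 u ξ‖ ≤ A := norm_fourier_le ξ
      have hb := hcub ξ
      have hn := norm_nonneg ξ
      have h8 : (1 + ‖ξ‖) ^ 3 ≤ 8 * (1 + ‖ξ‖ ^ 3) := by
        nlinarith [mul_nonneg (by linarith : (0 : ℝ) ≤ 1 + ‖ξ‖) (sq_nonneg (1 - ‖ξ‖)),
          pow_nonneg hn 3]
      calc (1 + ‖ξ‖) ^ 3 * ‖𝓕 u ξ‖ ≤ 8 * (1 + ‖ξ‖ ^ 3) * ‖𝓕 u ξ‖ := by gcongr
        _ = 8 * (‖𝓕 u ξ‖ + ‖ξ‖ ^ 3 * ‖𝓕 u ξ‖) := by ring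
        _ ≤ _ := by gcongr
    have hp : 0 < 1 + ‖ξ‖ := by positivity
    rw [Real.rpow_neg hp.le, show (6 : ℝ) = (6 : ℕ) by norm_num, Real.rpow_natCast,
      ← div_eq_mul_inv, le_div_iff₀ (by positivity)]
    calc ‖𝓕 u ξ‖ ^ 2 * (1 + ‖ξ‖) ^ 6 = ((1 + ‖ξ‖) ^ 3 * ‖𝓕 u ξ‖) ^ 2 := by ring
      _ ≤ _ := by gcongr
  rw [memLp_two_iff_integrable_sq_norm (continuous_fourier hu0).aestronglyMeasurable]
  refine Integrable.mono' ((integrable_one_add_norm (E := R3) (μ := volume) (r := 6)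
    (by simp; norm_num)).const_mul ((8 * (A + B)) ^ 2))
    ((continuous_fourier hu0).norm.pow 2).aestronglyMeasurable (.of_forall fun ξ => ?_)
  rw [Real.norm_of_nonneg (by positivity)]
  exact hbd ξ

/-! ### The Green kernel and its gradient in closed form. -/

/-- The symbol `e^{-zm}/m`, `m = 2π|ξ|`. -/
def greenSymbol (z : ℂ) (ξ : R3) : ℂ := Complex.exp (-z * freq ξ) / freq ξ

theorem norm_cexp_neg_mul_ofReal (z : ℂ) (m : ℝ) :
    ‖Complex.exp (-z * m)‖ = Real.exp (-(z.re * m)) := by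
  rw [Complex.norm_exp]; simp

theorem norm_greenSymbol (z : ℂ) (ξ : R3) :
    ‖greenSymbol z ξ‖ = Real.exp (-(z.re * freq ξ)) / freq ξ := by
  rw [greenSymbol, norm_div, norm_cexp_neg_mul_ofReal, Complex.norm_real,
    Real.norm_of_nonneg (freq_nonneg ξ)]

theorem continuous_freq : Continuous freq := by unfold freq; fun_prop

theorem measurable_greenSymbol : Measurable fun p : ℂ × R3 => greenSymbol p.1 p.2 := by
  have := continuous_freq.measurable
  unfold greenSymbol
  fun_prop

/-- In polar coordinates the radial density is `r^{k+2}` times an exponential; `k > -3` is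
integrability at the origin. -/
theorem integrable_exp_freq_mul_pow {a : ℝ} (ha : 0 < a) {k : ℝ} (hk : -3 < k) :
    Integrable fun ξ : R3 => Real.exp (-(a * freq ξ)) * ‖ξ‖ ^ k := by
  have := (integrable_fun_norm_addHaar (volume : Measure R3)
    (f := fun r => Real.exp (-(a * (2 * Real.pi * r))) * r ^ k)).2 ?_
  · exact this
  · have h := integrableOn_rpow_mul_exp_neg_mul_rpow (p := 1) (s := k + 2)
      (b := a * (2 * Real.pi)) (by linarith) one_pos (by positivity)
    refine h.congr_fun (fun r hr => ?_) measurableSet_Ioi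
    have hr : (0 : ℝ) < r := hr
    simp only [finrank_euclideanSpace, Fintype.card_fin, smul_eq_mul]
    rw [Real.rpow_add hr, Real.rpow_one]
    norm_num
    rw [show a * (2 * Real.pi) * r = a * (2 * Real.pi * r) by ring]
    ring

theorem integrable_exp_freq {a : ℝ} (ha : 0 < a) :
    Integrable fun ξ : R3 => Real.exp (-(a * freq ξ)) := by
  simpa using integrable_exp_freq_mul_pow ha (k := 0) (by norm_num)

theorem integrable_exp_freq_div {a : ℝ} (ha : 0 < a) :
    Integrable fun ξ : R3 => Real.exp (-(a * freq ξ)) / freq ξ := by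
  have := (integrable_exp_freq_mul_pow ha (k := -1) (by norm_num)).mul_const (2 * Real.pi)⁻¹
  refine this.congr (.of_forall fun ξ => ?_)
  simp only [Real.rpow_neg_one]
  rw [div_eq_mul_inv (Real.exp _), freq, mul_inv]
  ring

theorem integrable_greenSymbol {z : ℂ} (hz : 0 < z.re) : Integrable (greenSymbol z) :=
  (integrable_exp_freq_div hz).mono'
    (measurable_greenSymbol.comp measurable_prodMk_left).aestronglyMeasurable
    (.of_forall fun ξ => (norm_greenSymbol z ξ).le)

/-- The space `ℝ × ℂ` with its Euclidean norm, isometric to `ℝ³`. -/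
abbrev Cyl : Type := WithLp 2 (ℝ × ℂ)

theorem nonempty_cyl_isometry : Nonempty (Cyl ≃ₗᵢ[ℝ] R3) := by
  have h : Module.finrank ℝ Cyl = 3 := by
    rw [(WithLp.linearEquiv 2 ℝ (ℝ × ℂ)).finrank_eq, Module.finrank_prod]
    simp
  exact ⟨((stdOrthonormalBasis ℝ Cyl).reindex (finCongr h)).repr⟩

/-- With `S = √(a² + y²)` the area element satisfies `y dy = S dS`. This cancels the denominator and
leaves the elementary primitive `P`; `a ≠ 0` keeps `S` smooth at `y = 0`. -/
theorem integral_plane_exp {z : ℂ} (hz : 0 < z.re) {a : ℝ} (ha : a ≠ 0) :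
    ∫ q : ℂ, Complex.exp (-z * (2 * Real.pi * √(a ^ 2 + ‖q‖ ^ 2) : ℝ)) /
        (2 * Real.pi * √(a ^ 2 + ‖q‖ ^ 2) : ℝ)
      = Complex.exp (-(2 * Real.pi * z) * |a|) / (2 * Real.pi * z) := by
  have hz0 : z ≠ 0 := fun h => by simp [h] at hz
  have hpi : (Real.pi : ℂ) ≠ 0 := by simp [Real.pi_ne_zero]
  set S : ℝ → ℝ := fun y => √(a ^ 2 + y ^ 2) with hS
  have hpos : ∀ y, 0 < a ^ 2 + y ^ 2 := fun y => by positivity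
  have hSpos : ∀ y, 0 < S y := fun y => Real.sqrt_pos.2 (hpos y)
  rw [integral_fun_norm_addHaar volume (fun y : ℝ =>
    Complex.exp (-z * (2 * Real.pi * S y : ℝ)) / (2 * Real.pi * S y : ℝ))]
  set P : ℝ → ℂ := fun y => -Complex.exp (-z * (2 * Real.pi * S y : ℝ)) / (4 * Real.pi ^ 2 * z)
  have hder : ∀ y, HasDerivAt P
      (y * (Complex.exp (-z * (2 * Real.pi * S y : ℝ)) / (2 * Real.pi * S y : ℝ))) y := by
    intro y
    have h1 : HasDerivAt S (y / S y) y := by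
      have := (((hasDerivAt_pow 2 y)).const_add (a ^ 2)).sqrt (hpos y).ne'
      refine this.congr_deriv ?_
      change _ = y / √(a ^ 2 + y ^ 2)
      have := hSpos y
      field_simp
      norm_num
    have h2 := ((((h1.const_mul (2 * Real.pi)).ofReal_comp).const_mul (-z)).cexp.neg).div_const
      (4 * Real.pi ^ 2 * z)
    refine h2.congr_deriv ?_
    have : (S y : ℂ) ≠ 0 := by exact_mod_cast (hSpos y).ne'
    push_cast
    field_simp
    ring
  have hyS : ∀ y, 0 ≤ y → y ≤ S y := fun y hy => by
    refine Real.le_sqrt_of_sq_le ?_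
    nlinarith [sq_nonneg a]
  have hbd : ∀ y, 0 ≤ y → ‖Complex.exp (-z * (2 * Real.pi * S y : ℝ))‖
      ≤ Real.exp (-(z.re * (2 * Real.pi)) * y) := fun y hy => by
    rw [norm_cexp_neg_mul_ofReal]
    refine Real.exp_le_exp.2 ?_
    have := mul_le_mul_of_nonneg_left (hyS y hy) (by positivity : 0 ≤ z.re * (2 * Real.pi))
    linarith
  have hcont : Continuous S := by simp only [hS]; fun_prop
  have hint : IntegrableOn (fun y : ℝ => (y : ℂ) *
      (Complex.exp (-z * (2 * Real.pi * S y : ℝ)) / (2 * Real.pi * S y : ℝ))) (Set.Ioi 0) := by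
    have hexp := (exp_neg_integrableOn_Ioi 0
      (by positivity : 0 < z.re * (2 * Real.pi))).mul_const (2 * Real.pi)⁻¹
    refine Integrable.mono' hexp ?_ ((ae_restrict_mem measurableSet_Ioi).mono fun y hy => ?_)
    · refine (Measurable.mul (by fun_prop) (Measurable.div ?_ ?_)).aestronglyMeasurable
      · exact (by fun_prop : Continuous fun y =>
          Complex.exp (-z * (2 * Real.pi * S y : ℝ))).measurable
      · exact (by fun_prop : Continuous fun y => ((2 * Real.pi * S y : ℝ) : ℂ)).measurable
    · have hy : 0 < y := hy
      rw [norm_mul, norm_div, Complex.norm_real, Complex.norm_real, Real.norm_of_nonneg hy.le,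
        Real.norm_of_nonneg (by have := hSpos y; positivity)]
      calc y * (‖Complex.exp (-z * (2 * Real.pi * S y : ℝ))‖ / (2 * Real.pi * S y))
          = ‖Complex.exp (-z * (2 * Real.pi * S y : ℝ))‖ * (2 * Real.pi)⁻¹ * (y / S y) := by
            have := hSpos y
            field_simp
        _ ≤ Real.exp (-(z.re * (2 * Real.pi)) * y) * (2 * Real.pi)⁻¹ * 1 := by
            gcongr
            · exact hbd y hy.le
            · exact (div_le_one (hSpos y)).2 (hyS y hy.le)
        _ = _ := mul_one _
  have hlim : Tendsto P atTop (𝓝 0) := by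
    have h1 : Tendsto (fun y => Real.exp (-(z.re * (2 * Real.pi)) * y)) atTop (𝓝 0) := by
      refine Real.tendsto_exp_atBot.comp ?_
      exact tendsto_id.const_mul_atTop_of_neg (by have := Real.pi_pos; nlinarith)
    have h2 : Tendsto (fun y => Complex.exp (-z * (2 * Real.pi * S y : ℝ))) atTop (𝓝 0) :=
      squeeze_zero_norm' ((eventually_ge_atTop 0).mono hbd) h1
    have h3 := (h2.neg).div_const (4 * Real.pi ^ 2 * z)
    rwa [neg_zero, zero_div] at h3
  have h := integral_Ioi_of_hasDerivAt_of_tendsto (hder 0).continuousAt.continuousWithinAt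
    (fun y _ => hder y) hint hlim
  have hS0 : S 0 = |a| := by simp [hS, Real.sqrt_sq_eq_abs]
  simp only [Complex.finrank_real_complex, Measure.real, Complex.volume_ball]
  simp only [pow_one, Nat.reduceSub, Complex.real_smul]
  rw [h]
  simp only [P, hS0]
  simp
  field_simp
  ring_nf

theorem integral_exp_abs {z : ℂ} {r : ℝ} (hz : 0 < z.re) :
    ∫ a : ℝ, Complex.exp (2 * Real.pi * Complex.I * r * a) * Complex.exp (-(2 * Real.pi * z) * |a|)
      = z / (Real.pi * (z ^ 2 + r ^ 2)) := by
  have hpi : (Real.pi : ℂ) ≠ 0 := by simp [Real.pi_ne_zero]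
  set α : ℂ := 2 * Real.pi * (-z + Complex.I * r) with hα
  set β : ℂ := 2 * Real.pi * (z + Complex.I * r) with hβ
  have hαr : α.re < 0 := by simp [hα]; have := Real.pi_pos; positivity
  have hβr : 0 < β.re := by simp [hβ]; have := Real.pi_pos; positivity
  set f : ℝ → ℂ := fun a =>
    Complex.exp (2 * Real.pi * Complex.I * r * a) * Complex.exp (-(2 * Real.pi * z) * |a|)
  have hfI : ∀ a ∈ Set.Ioi (0 : ℝ), f a = Complex.exp (α * a) := fun a ha => by
    have ha : 0 < a := ha
    simp only [f, abs_of_pos ha, ← Complex.exp_add, hα]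
    ring_nf
  have hfJ : ∀ a ∈ Set.Iic (0 : ℝ), f a = Complex.exp (β * a) := fun a ha => by
    have ha : a ≤ 0 := ha
    simp only [f, abs_of_nonpos ha, ← Complex.exp_add, hβ]
    push_cast
    ring_nf
  have hI : IntegrableOn f (Set.Ioi 0) :=
    (integrableOn_exp_mul_complex_Ioi hαr 0).congr_fun (fun a ha => (hfI a ha).symm)
      measurableSet_Ioi
  have hJ : IntegrableOn f (Set.Iic 0) :=
    (integrableOn_exp_mul_complex_Iic hβr 0).congr_fun (fun a ha => (hfJ a ha).symm)
      measurableSet_Iic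
  have h := intervalIntegral.integral_Iic_add_Ioi hJ hI
  rw [← h, setIntegral_congr_fun measurableSet_Ioi hfI,
    setIntegral_congr_fun measurableSet_Iic hfJ, integral_exp_mul_complex_Ioi hαr,
    integral_exp_mul_complex_Iic hβr]
  have h1 : -z + Complex.I * r ≠ 0 := fun h => by simp [hα, h] at hαr
  have h2 : z + Complex.I * r ≠ 0 := fun h => by simp [hβ, h] at hβr
  have h3 : z ^ 2 + (r : ℂ) ^ 2 ≠ 0 := by
    have : z ^ 2 + (r : ℂ) ^ 2 = -((-z + Complex.I * r) * (z + Complex.I * r)) := by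
      ring_nf; rw [Complex.I_sq]; ring
    rw [this]
    exact neg_ne_zero.2 (mul_ne_zero h1 h2)
  simp only [hα, hβ, Complex.ofReal_zero, mul_zero, Complex.exp_zero]
  field_simp
  ring_nf
  rw [Complex.I_sq]
  ring

/-- The symbol is radial, so a reflection moves `x` onto the axis of `ℝ × ℂ`. By Fubini, the
integral over each plane orthogonal to the axis is exact, and a one-dimensional transform of
`e^{-2πz|a|}` remains. -/
theorem fourierInv_greenSymbol {z : ℂ} (hz : 0 < z.re) (x : R3) :
    𝓕⁻ (greenSymbol z) x = 1 / (2 * Real.pi ^ 2 * (z ^ 2 + (‖x‖ : ℂ) ^ 2)) := by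
  obtain ⟨L⟩ := nonempty_cyl_isometry
  set r := ‖x‖
  set v : Cyl := WithLp.toLp 2 (r, 0) with hv
  have hvn : ‖L v‖ = ‖x‖ := by
    rw [L.norm_map, hv, WithLp.prod_norm_eq_of_L2]
    simp [r]
  set A : R3 ≃ₗᵢ[ℝ] R3 := (ℝ ∙ (x - L v))ᗮ.reflection
  have hA : A x = L v := Submodule.reflection_sub hvn.symm
  have hrad : ∀ {W : Type} [NormedAddCommGroup W] [InnerProductSpace ℝ W] (B : W ≃ₗᵢ[ℝ] R3) (w : W),
      greenSymbol z (B w) = Complex.exp (-z * (2 * Real.pi * ‖w‖ : ℝ)) / (2 * Real.pi * ‖w‖ : ℝ) := by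
    intro W _ _ B w
    simp only [greenSymbol, freq, B.norm_map]
  have h1 : 𝓕⁻ (greenSymbol z) x = 𝓕⁻ (greenSymbol z ∘ L) v := by
    rw [Real.fourierInv_comp_linearIsometry, ← hA, ← Real.fourierInv_comp_linearIsometry]
    have : greenSymbol z ∘ A = greenSymbol z := funext fun ξ => by
      simp only [Function.comp, greenSymbol, freq, A.norm_map]
    rw [this]
  set G : ℝ × ℂ → ℂ := fun p => Complex.exp (2 * Real.pi * Complex.I * r * p.1) *
    (Complex.exp (-z * (2 * Real.pi * √(p.1 ^ 2 + ‖p.2‖ ^ 2) : ℝ)) /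
      (2 * Real.pi * √(p.1 ^ 2 + ‖p.2‖ ^ 2) : ℝ)) with hG
  have hmp : MeasurePreserving (MeasurableEquiv.toLp 2 (ℝ × ℂ)) :=
    WithLp.volume_preserving_toLp ℝ ℂ
  have hgG : ∀ p : ℝ × ℂ, Complex.exp ((2 * Real.pi * inner ℝ (WithLp.toLp 2 p : Cyl) v : ℝ) *
      Complex.I) * greenSymbol z (L (WithLp.toLp 2 p)) = G p := by
    intro p
    simp only [greenSymbol, freq, L.norm_map, WithLp.prod_norm_eq_of_L2, hG, hv,
      WithLp.prod_inner_apply, Real.norm_eq_abs, sq_abs, inner_zero_right, add_zero]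
    congr 2
    simp
    ring
  have hintG : Integrable G := by
    have h2 : Integrable (fun p : ℝ × ℂ => greenSymbol z (L (WithLp.toLp 2 p))) :=
      hmp.integrable_comp_of_integrable
        (L.measurePreserving.integrable_comp_of_integrable (integrable_greenSymbol hz))
    refine (integrable_congr (.of_forall hgG)).1 (h2.bdd_mul (c := 1) ?_ ?_)
    · have : Continuous fun p : ℝ × ℂ => Complex.exp
          ((2 * Real.pi * inner ℝ (WithLp.toLp 2 p : Cyl) v : ℝ) * Complex.I) := by fun_prop
      exact this.aestronglyMeasurable
    · exact .of_forall fun p => (Complex.norm_exp_ofReal_mul_I _).le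
  have h2 : 𝓕⁻ (greenSymbol z ∘ L) v = ∫ p, G p := by
    rw [Real.fourierInv_eq', ← hmp.integral_comp']
    exact integral_congr_ae (.of_forall hgG)
  rw [h1, h2, Measure.volume_eq_prod, integral_prod _ hintG]
  have h3 : ∀ᵐ a : ℝ, ∫ q : ℂ, G (a, q) = (Complex.exp (2 * Real.pi * Complex.I * r * a) *
      Complex.exp (-(2 * Real.pi * z) * |a|)) / (2 * Real.pi * z) := by
    filter_upwards [Measure.ae_ne volume (0 : ℝ)] with a ha
    simp only [hG]
    rw [integral_const_mul, integral_plane_exp hz ha]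
    ring
  rw [integral_congr_ae h3, integral_div, integral_exp_abs hz]
  have hz0 : z ≠ 0 := fun h => by simp [h] at hz
  have hpi : (Real.pi : ℂ) ≠ 0 := by simp [Real.pi_ne_zero]
  field_simp

theorem sq_add_sq_ne_zero {z : ℂ} (hz : 0 < z.re) (r : ℝ) : z ^ 2 + (r : ℂ) ^ 2 ≠ 0 := by
  have h1 : z + Complex.I * r ≠ 0 := fun h => by
    have := congrArg Complex.re h; simp at this; linarith
  have h2 : z - Complex.I * r ≠ 0 := fun h => by
    have := congrArg Complex.re h; simp at this; linarith
  have : z ^ 2 + (r : ℂ) ^ 2 = (z + Complex.I * r) * (z - Complex.I * r) := by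
    ring_nf; rw [Complex.I_sq]; ring
  rw [this]
  exact mul_ne_zero h1 h2

theorem fourier_greenSymbol {z : ℂ} (hz : 0 < z.re) (x : R3) :
    𝓕 (greenSymbol z) x = 1 / (2 * Real.pi ^ 2 * (z ^ 2 + (‖x‖ : ℂ) ^ 2)) := by
  have h := Real.fourierInv_eq_fourier_neg (greenSymbol z) (-x)
  rw [neg_neg] at h
  rw [← h, fourierInv_greenSymbol hz, norm_neg]

theorem integrable_norm_mul_greenSymbol {z : ℂ} (hz : 0 < z.re) :
    Integrable fun ξ : R3 => ‖ξ‖ * ‖greenSymbol z ξ‖ := by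
  refine ((integrable_exp_freq hz).mul_const (2 * Real.pi)⁻¹).mono' ?_ (.of_forall fun ξ => ?_)
  · exact (measurable_norm.mul (measurable_greenSymbol.comp
      measurable_prodMk_left).norm).aestronglyMeasurable
  · rw [Real.norm_of_nonneg (by positivity), norm_greenSymbol, freq]
    rcases eq_or_ne ‖ξ‖ 0 with h | h
    · rw [h]; simp [Real.pi_pos.le]
    · field_simp
      exact le_rfl

theorem fderiv_inv_sq_add_norm_sq {z : ℂ} (hz : 0 < z.re) (x : R3) (j : Fin 3) :
    fderiv ℝ (fun x : R3 => 1 / (2 * Real.pi ^ 2 * (z ^ 2 + (‖x‖ : ℂ) ^ 2))) x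
      (EuclideanSpace.single j (1 : ℝ)) = -(x j / (Real.pi ^ 2 * (z ^ 2 + (‖x‖ : ℂ) ^ 2) ^ 2)) := by
  have hpi : (Real.pi : ℂ) ≠ 0 := by simp [Real.pi_ne_zero]
  have hne := sq_add_sq_ne_zero hz ‖x‖
  have h1 : HasFDerivAt (fun x : R3 => (‖x‖ : ℂ) ^ 2) _ x :=
    (Complex.ofRealCLM.hasFDerivAt.comp x (hasStrictFDerivAt_norm_sq x).hasFDerivAt).congr_of_eventuallyEq
      (.of_forall fun y => by simp)
  have h2 := (h1.const_add (z ^ 2)).const_mul (2 * Real.pi ^ 2 : ℂ)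
  have hne2 : 2 * (Real.pi : ℂ) ^ 2 * (z ^ 2 + (‖x‖ : ℂ) ^ 2) ≠ 0 := by
    refine mul_ne_zero (mul_ne_zero two_ne_zero (pow_ne_zero _ hpi)) hne
  have h3 := (hasDerivAt_inv hne2).comp_hasFDerivAt x h2
  have h4 : HasFDerivAt (fun x : R3 => 1 / (2 * Real.pi ^ 2 * (z ^ 2 + (‖x‖ : ℂ) ^ 2))) _ x :=
    h3.congr_of_eventuallyEq (.of_forall fun y => by simp [one_div])
  rw [h4.fderiv]
  simp [EuclideanSpace.inner_single_right]
  field_simp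

/-- Multiplication by `2πiξⱼ` differentiates the kernel. The derivative formula is available for
`𝓕`, hence the evaluation at `-x`. -/
theorem fourierInv_deriv_greenSymbol {z : ℂ} (hz : 0 < z.re) (j : Fin 3) (x : R3) :
    𝓕⁻ (fun ξ => 2 * Real.pi * Complex.I * ξ j * greenSymbol z ξ) x
      = -(x j / (Real.pi ^ 2 * (z ^ 2 + (‖x‖ : ℂ) ^ 2) ^ 2)) := by
  have hi := integrable_greenSymbol hz
  have hi1 := integrable_norm_mul_greenSymbol hz
  have h := Real.hasFDerivAt_fourier hi hi1 (-x)
  have hF : 𝓕 (greenSymbol z) = fun x : R3 => 1 / (2 * Real.pi ^ 2 * (z ^ 2 + (‖x‖ : ℂ) ^ 2)) :=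
    funext (fourier_greenSymbol hz)
  rw [hF] at h
  have h1 := fderiv_inv_sq_add_norm_sq hz (-x) j
  have hint : Integrable (VectorFourier.fourierSMulRight (innerSL ℝ) (greenSymbol z)) := by
    refine Integrable.mono' (hi1.const_mul (2 * Real.pi * ‖innerSL (E := R3) ℝ‖))
      hi.1.fourierSMulRight (.of_forall fun ξ => ?_)
    refine (VectorFourier.norm_fourierSMulRight_le _ _ _).trans (le_of_eq ?_)
    ring
  rw [h.fderiv, Real.fourier_continuousLinearMap_apply hint] at h1
  rw [Real.fourierInv_eq_fourier_neg]
  have h2 : (fun ξ : R3 => 2 * Real.pi * Complex.I * ξ j * greenSymbol z ξ) =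
      fun ξ => -((VectorFourier.fourierSMulRight (innerSL ℝ) (greenSymbol z)) ξ
        (EuclideanSpace.single j 1)) := by
    funext ξ
    have h3 : innerSL ℝ ξ (EuclideanSpace.single j (1 : ℝ)) = ξ j := by
      simp [innerSL_apply_apply, EuclideanSpace.inner_single_right]
    simp only [VectorFourier.fourierSMulRight_apply, h3, smul_eq_mul, Complex.real_smul]
    ring
  rw [h2]
  rw [fourier_eq_integral_planeWave] at h1 ⊢
  simp only [neg_mul, integral_neg]
  rw [h1]
  simp [neg_div]

/-! ### Pointwise bounds on the kernels. -/

/-- `|z² + r²|` dominates `s (s² + (r+t)²)^{1/2}` when `z = σ + it` and `σ ≥ s`. -/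
theorem le_norm_sq_add_sq {σ s t r : ℝ} (hs : 0 ≤ s) (hσ : s ≤ σ) :
    s * √(s ^ 2 + (r + t) ^ 2) ≤ ‖((σ : ℂ) + Complex.I * t) ^ 2 + (r : ℂ) ^ 2‖ := by
  -- The factor with `t - r` degenerates on the light cone and is only bounded below by `s`; the
  -- factor with `t + r` carries the decay.
  have h : ((σ : ℂ) + Complex.I * t) ^ 2 + (r : ℂ) ^ 2
      = ((σ : ℂ) + (t - r : ℝ) * Complex.I) * ((σ : ℂ) + (t + r : ℝ) * Complex.I) := by
    push_cast; ring_nf; rw [Complex.I_sq]; ring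
  rw [h, norm_mul, Complex.norm_add_mul_I, Complex.norm_add_mul_I]
  refine mul_le_mul (Real.le_sqrt_of_sq_le ?_) (Real.sqrt_le_sqrt ?_) (Real.sqrt_nonneg _)
    (Real.sqrt_nonneg _)
  · nlinarith [sq_nonneg (t - r)]
  · rw [add_comm r t]
    gcongr

theorem norm_fourierInv_greenSymbol_le {σ s t : ℝ} (hs : 0 < s) (hσ : s ≤ σ) (ht : 0 ≤ t)
    (x : R3) : ‖𝓕⁻ (greenSymbol ((σ : ℂ) + Complex.I * t)) x‖ ≤ 1 / (s * √(s ^ 2 + t ^ 2)) := by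
  rw [fourierInv_greenSymbol (by simp; linarith)]
  have h := le_norm_sq_add_sq (t := t) (r := ‖x‖) hs.le hσ
  have h0 : 0 < s * √(s ^ 2 + t ^ 2) := by positivity
  have h1 : s * √(s ^ 2 + t ^ 2) ≤ s * √(s ^ 2 + (‖x‖ + t) ^ 2) := by
    gcongr
    linarith [norm_nonneg x]
  rw [norm_div, norm_one, norm_mul]
  refine one_div_le_one_div_of_le h0 ?_
  have h2 : (1 : ℝ) ≤ ‖(2 * (Real.pi : ℂ) ^ 2)‖ := by
    simp only [norm_mul, norm_pow, Complex.norm_ofNat, Complex.norm_real,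
      Real.norm_of_nonneg Real.pi_pos.le]
    nlinarith [Real.pi_gt_three]
  calc _ ≤ 1 * _ := (h1.trans h).trans_eq (one_mul _).symm
    _ ≤ _ := by gcongr

theorem norm_fourierInv_deriv_greenSymbol_le {σ s t : ℝ} (hs : 0 < s) (hσ : s ≤ σ)
    (j : Fin 3) (x : R3) :
    ‖𝓕⁻ (fun ξ => 2 * Real.pi * Complex.I * ξ j * greenSymbol ((σ : ℂ) + Complex.I * t) ξ) x‖
      ≤ ‖x‖ / (s ^ 2 * (s ^ 2 + (‖x‖ + t) ^ 2)) := by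
  rw [fourierInv_deriv_greenSymbol (by simp; linarith)]
  have h := le_norm_sq_add_sq (t := t) (r := ‖x‖) hs.le hσ
  have h0 : 0 < s ^ 2 + (‖x‖ + t) ^ 2 := by positivity
  rw [norm_neg, norm_div, norm_mul, norm_pow, norm_pow, Complex.norm_real, Complex.norm_real]
  have h3 : s ^ 2 * (s ^ 2 + (‖x‖ + t) ^ 2) = (s * √(s ^ 2 + (‖x‖ + t) ^ 2)) ^ 2 := by
    rw [mul_pow, Real.sq_sqrt h0.le]
  rw [h3]
  have h2 : (1 : ℝ) ≤ ‖Real.pi‖ ^ 2 := by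
    rw [Real.norm_of_nonneg Real.pi_pos.le]
    nlinarith [Real.pi_gt_three]
  gcongr
  · exact PiLp.norm_apply_le x j
  · calc _ ≤ 1 * _ := (pow_le_pow_left₀ (by positivity) h 2).trans_eq (one_mul _).symm
      _ ≤ _ := by gcongr

/-! ### Averaging over the shift `s` against the cutoff weight. -/

theorem fourierInv_average {K : ℝ → R3 → ℂ} (hK : Measurable (Function.uncurry K)) {b : R3 → ℝ}
    (hb : Integrable b) (hKb : ∀ s ∈ Set.Ioc (0 : ℝ) 1, ∀ ξ, ‖K s ξ‖ ≤ b ξ) :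
    Integrable (fun ξ => ∫ s in Set.Ioc (0 : ℝ) 1, K s ξ) ∧
    ∀ x, 𝓕⁻ (fun ξ => ∫ s in Set.Ioc (0 : ℝ) 1, K s ξ) x
      = ∫ s in Set.Ioc (0 : ℝ) 1, 𝓕⁻ (K s) x := by
  set μ : Measure ℝ := volume.restrict (Set.Ioc 0 1) with hμ
  have hint : Integrable (Function.uncurry fun ξ s => K s ξ) (volume.prod μ) := by
    refine Integrable.mono' (g := fun p => b p.1) (hb.comp_fst μ)
      (hK.comp measurable_swap).aestronglyMeasurable ?_
    have : ∀ᵐ p ∂((volume : Measure R3).prod μ), p.2 ∈ Set.Ioc (0 : ℝ) 1 :=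
      Measure.quasiMeasurePreserving_snd.ae (ae_restrict_mem measurableSet_Ioc)
    filter_upwards [this] with p hp
    exact hKb _ hp _
  refine ⟨hint.integral_prod_left, fun x => ?_⟩
  simp only [Real.fourierInv_eq']
  have hint2 : Integrable (Function.uncurry fun (ξ : R3) (s : ℝ) =>
      Complex.exp ((2 * Real.pi * inner ℝ ξ x : ℝ) * Complex.I) • K s ξ) (volume.prod μ) := by
    refine hint.bdd_smul (C := 1) (φ := fun p : R3 × ℝ =>
      Complex.exp ((2 * Real.pi * inner ℝ p.1 x : ℝ) * Complex.I)) ?_ ?_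
    · have : Continuous fun p : R3 × ℝ =>
        Complex.exp ((2 * Real.pi * inner ℝ p.1 x : ℝ) * Complex.I) := by fun_prop
      exact this.aestronglyMeasurable
    · exact .of_forall fun p => (Complex.norm_exp_ofReal_mul_I _).le
  rw [← integral_integral_swap hint2]
  simp only [integral_smul]

/-- A polynomial `g` with `g(0) = g'(0) = 0`, `g''(0) = 1` that vanishes to fourth order at `1`. -/
def cutoff (s : ℝ) : ℝ := (s ^ 2 - 4 * s ^ 6 + 6 * s ^ 10 - 4 * s ^ 14 + s ^ 18) / 2

/-- Minus the fourth derivative of `cutoff`. -/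
def cutoffDeriv (s : ℝ) : ℝ := 720 * s ^ 2 - 15120 * s ^ 6 + 48048 * s ^ 10 - 36720 * s ^ 14

theorem continuous_cutoff : Continuous cutoff := by unfold cutoff; fun_prop

theorem continuous_cutoffDeriv : Continuous cutoffDeriv := by unfold cutoffDeriv; fun_prop

/-- The weight is `s²(1 - s⁴)⁴/2`. Its factor `s²` is what cancels the `s⁻²` in the bound for the
gradient kernel. -/
theorem abs_cutoff_le {s : ℝ} (hs : s ∈ Set.Ioc (0 : ℝ) 1) : |cutoff s| ≤ s ^ 2 := by
  have h : cutoff s = s ^ 2 * ((1 - s ^ 4) ^ 4 / 2) := by unfold cutoff; ring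
  have h1 : s ^ 4 ≤ 1 := pow_le_one₀ hs.1.le hs.2
  have h2 : 0 ≤ s ^ 4 := by positivity
  have h3 : (1 - s ^ 4) ^ 4 ≤ 1 := pow_le_one₀ (by linarith) (by linarith)
  have h4 : 0 ≤ (1 - s ^ 4) ^ 4 := by positivity
  rw [h, abs_of_nonneg (by positivity)]
  exact mul_le_of_le_one_right (sq_nonneg s) (by linarith)

/-- Since `cutoff` contains only the powers `s^{2+4k}`, its fourth derivative is again `O(s²)`. The
constant is the sum `720 + 15120 + 48048 + 36720`. -/
theorem abs_cutoffDeriv_le {s : ℝ} (hs : s ∈ Set.Ioc (0 : ℝ) 1) :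
    |cutoffDeriv s| ≤ 100608 * s ^ 2 := by
  have h : cutoffDeriv s = s ^ 2 * (720 - 15120 * s ^ 4 + 48048 * s ^ 8 - 36720 * s ^ 12) := by
    unfold cutoffDeriv; ring
  have hp : ∀ n, 0 ≤ s ^ n ∧ s ^ n ≤ 1 := fun n => ⟨pow_nonneg hs.1.le n, pow_le_one₀ hs.1.le hs.2⟩
  rw [h, abs_mul, abs_of_nonneg (sq_nonneg s), mul_comm]
  gcongr
  rw [abs_le]
  constructor <;> linarith [hp 4, hp 8, hp 12, (hp 4).1, (hp 8).1, (hp 12).1, (hp 4).2, (hp 8).2,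
    (hp 12).2]

/-- Four integrations by parts, packed into the single primitive `Φ`. The only boundary term is
`g''(0) = 1`: the third derivative also vanishes at `0`, and all derivatives up to order three
vanish at `1`. -/
theorem integral_cutoff {m : ℝ} (hm : 0 < m) :
    m ^ 3 * (∫ s in Set.Ioc (0 : ℝ) 1, cutoff s * Real.exp (-(s * m)))
      + (∫ s in Set.Ioc (0 : ℝ) 1, cutoffDeriv s * Real.exp (-(s * m))) / m = 1 := by
  set g1 : ℝ → ℝ := fun s => s - 12 * s ^ 5 + 30 * s ^ 9 - 28 * s ^ 13 + 9 * s ^ 17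
  set g2 : ℝ → ℝ := fun s => 1 - 60 * s ^ 4 + 270 * s ^ 8 - 364 * s ^ 12 + 153 * s ^ 16
  set g3 : ℝ → ℝ := fun s => -240 * s ^ 3 + 2160 * s ^ 7 - 4368 * s ^ 11 + 2448 * s ^ 15
  have hd0 : ∀ s, HasDerivAt cutoff (g1 s) s := fun s => by
    have := (((((hasDerivAt_pow 2 s).sub ((hasDerivAt_pow 6 s).const_mul 4)).add
      ((hasDerivAt_pow 10 s).const_mul 6)).sub ((hasDerivAt_pow 14 s).const_mul 4)).add
      (hasDerivAt_pow 18 s)).div_const 2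
    exact this.congr_deriv (by simp only [g1]; push_cast; ring)
  have hd1 : ∀ s, HasDerivAt g1 (g2 s) s := fun s => by
    have := ((((hasDerivAt_id s).sub ((hasDerivAt_pow 5 s).const_mul 12)).add
      ((hasDerivAt_pow 9 s).const_mul 30)).sub ((hasDerivAt_pow 13 s).const_mul 28)).add
      ((hasDerivAt_pow 17 s).const_mul 9)
    exact this.congr_deriv (by simp only [g2]; push_cast; ring)
  have hd2 : ∀ s, HasDerivAt g2 (g3 s) s := fun s => by
    have := ((((hasDerivAt_const s (1 : ℝ)).sub ((hasDerivAt_pow 4 s).const_mul 60)).add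
      ((hasDerivAt_pow 8 s).const_mul 270)).sub ((hasDerivAt_pow 12 s).const_mul 364)).add
      ((hasDerivAt_pow 16 s).const_mul 153)
    exact this.congr_deriv (by simp only [g3]; push_cast; ring)
  have hd3 : ∀ s, HasDerivAt g3 (-cutoffDeriv s) s := fun s => by
    have := ((((hasDerivAt_pow 3 s).const_mul (-240)).add
      ((hasDerivAt_pow 7 s).const_mul 2160)).sub ((hasDerivAt_pow 11 s).const_mul 4368)).add
      ((hasDerivAt_pow 15 s).const_mul 2448)
    exact this.congr_deriv (by unfold cutoffDeriv; push_cast; ring)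
  set Φ : ℝ → ℝ := fun s =>
    -((cutoff s * m ^ 2 + g1 s * m + g2 s + g3 s / m) * Real.exp (-(s * m)))
  have hΦ : ∀ s, HasDerivAt Φ (m ^ 3 * (cutoff s * Real.exp (-(s * m)))
      + cutoffDeriv s * Real.exp (-(s * m)) / m) s := fun s => by
    have he : HasDerivAt (fun s => Real.exp (-(s * m))) (Real.exp (-(s * m)) * -(1 * m)) s :=
      ((hasDerivAt_id s).mul_const m).neg.exp
    have := ((((((hd0 s).mul_const (m ^ 2)).add ((hd1 s).mul_const m)).add (hd2 s)).add
      ((hd3 s).div_const m)).mul he).neg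
    refine this.congr_deriv ?_
    simp only [Pi.add_apply]
    field_simp
    ring
  have hc0 : Continuous fun s => cutoff s * Real.exp (-(s * m)) :=
    continuous_cutoff.mul (by fun_prop)
  have hc1 : Continuous fun s => cutoffDeriv s * Real.exp (-(s * m)) :=
    continuous_cutoffDeriv.mul (by fun_prop)
  have h := intervalIntegral.integral_eq_sub_of_hasDerivAt (a := 0) (b := 1) (fun s _ => hΦ s)
    (((hc0.const_mul _).add (hc1.div_const m)).intervalIntegrable 0 1)
  rw [intervalIntegral.integral_add ((hc0.const_mul _).intervalIntegrable 0 1)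
    ((hc1.div_const m).intervalIntegrable 0 1), intervalIntegral.integral_const_mul,
    intervalIntegral.integral_div, intervalIntegral.integral_of_le zero_le_one,
    intervalIntegral.integral_of_le zero_le_one] at h
  rw [h]
  simp only [Φ, g1, g2, g3, cutoff]
  norm_num

/-- For `t ≥ 1` the bound holds pointwise in `s`. For `t ≤ 1` the integrand can be large, but it
lies below the Poisson kernel `r/(s² + r²)`, whose integral is less than `π/2 < 2`, while `⟨t⟩⁻¹ ≥
1/2`. -/
theorem integral_div_sq_add_sq_le {r : ℝ} (hr : 0 ≤ r) {t : ℝ} (ht : 0 ≤ t) :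
    ∫ s in Set.Ioc (0 : ℝ) 1, r / (s ^ 2 + (r + t) ^ 2) ≤ 4 * (√(1 + t ^ 2))⁻¹ := by
  rcases hr.eq_or_lt with rfl | hr
  · simp
  have hpos : ∀ s : ℝ, 0 < s ^ 2 + (r + t) ^ 2 := fun s => by positivity
  have hint : IntegrableOn (fun s : ℝ => r / (s ^ 2 + (r + t) ^ 2)) (Set.Ioc 0 1) := by
    refine Continuous.integrableOn_Ioc ?_
    exact continuous_const.div (by fun_prop) fun s => (hpos s).ne'
  rcases le_total 1 t with h1 | h1
  · have hb : ∀ s ∈ Set.Ioc (0 : ℝ) 1, r / (s ^ 2 + (r + t) ^ 2) ≤ 4 * (√(1 + t ^ 2))⁻¹ := by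
      intro s _
      have hsq : √(1 + t ^ 2) ≤ 2 * t := by
        rw [Real.sqrt_le_left (by positivity)]; nlinarith
      have h0 : 0 < √(1 + t ^ 2) := Real.sqrt_pos.2 (by positivity)
      rw [← div_eq_mul_inv, div_le_div_iff₀ (hpos s) h0]
      nlinarith [mul_le_mul_of_nonneg_left hsq hr.le, sq_nonneg s, sq_nonneg (r - t), mul_pos hr hr]
    calc _ ≤ ∫ _ in Set.Ioc (0 : ℝ) 1, 4 * (√(1 + t ^ 2))⁻¹ :=
          setIntegral_mono_on hint (continuous_const.integrableOn_Ioc) measurableSet_Ioc hb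
      _ = _ := by simp
  · have hpos' : ∀ s : ℝ, 0 < s ^ 2 + r ^ 2 := fun s => by positivity
    have hc : Continuous fun s : ℝ => r / (s ^ 2 + r ^ 2) :=
      continuous_const.div (by fun_prop) fun s => (hpos' s).ne'
    have hder : ∀ s : ℝ, HasDerivAt (fun s => Real.arctan (s / r)) (r / (s ^ 2 + r ^ 2)) s :=
      fun s => by
        refine ((hasDerivAt_id s).div_const r).arctan.congr_deriv ?_
        simp only [id]
        have := hpos' s
        field_simp
        ring
    have h := intervalIntegral.integral_eq_sub_of_hasDerivAt (a := 0) (b := 1)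
      (fun s _ => hder s) (hc.intervalIntegrable 0 1)
    rw [intervalIntegral.integral_of_le zero_le_one, zero_div, Real.arctan_zero, sub_zero] at h
    have hJ : (1 : ℝ) / 2 ≤ (√(1 + t ^ 2))⁻¹ := by
      rw [one_div]
      refine inv_anti₀ (Real.sqrt_pos.2 (by positivity)) ?_
      rw [Real.sqrt_le_left (by norm_num)]; nlinarith
    calc _ ≤ ∫ s in Set.Ioc (0 : ℝ) 1, r / (s ^ 2 + r ^ 2) := by
          refine setIntegral_mono_on hint hc.integrableOn_Ioc measurableSet_Ioc fun s _ => ?_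
          have := hpos' s
          gcongr
          linarith
      _ = Real.arctan (1 / r) := h
      _ ≤ 2 := by linarith [Real.arctan_lt_pi_div_two (1 / r), Real.pi_lt_four]
      _ ≤ _ := by linarith

theorem div_sqrt_le {s t : ℝ} (hs : s ∈ Set.Ioc (0 : ℝ) 1) :
    s / √(s ^ 2 + t ^ 2) ≤ (√(1 + t ^ 2))⁻¹ := by
  have h0 := hs.1
  have h1 := hs.2
  rw [inv_eq_one_div, div_le_div_iff₀ (Real.sqrt_pos.2 (by positivity))
    (Real.sqrt_pos.2 (by positivity)), one_mul]
  refine Real.le_sqrt_of_sq_le ?_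
  rw [mul_pow, Real.sq_sqrt (by positivity)]
  nlinarith [mul_le_one₀ h1 h0.le h1, sq_nonneg t]

/-! ### Decomposition of the damped propagator and its uniform bound. -/

theorem fourierInv_const_mul (a : ℂ) (f : R3 → ℂ) (x : R3) :
    𝓕⁻ (fun ξ => a * f ξ) x = a * 𝓕⁻ f x := by
  simp only [Real.fourierInv_eq', smul_eq_mul]
  rw [← integral_const_mul]
  refine integral_congr_ae (.of_forall fun ξ => ?_)
  simp only
  ring

theorem fourierInv_add {f g : R3 → ℂ} (hf : Integrable f) (hg : Integrable g) (x : R3) :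
    𝓕⁻ (fun ξ => f ξ + g ξ) x = 𝓕⁻ f x + 𝓕⁻ g x := by
  simp only [Real.fourierInv_eq_fourier_neg, fourier_eq_integral_planeWave, add_mul]
  have h : ∀ {f : R3 → ℂ}, Integrable f → Integrable fun y => f y * planeWave (-x) y :=
    fun hf => hf.mul_bdd (c := 1) (contDiff_planeWave _).continuous.aestronglyMeasurable
      (.of_forall fun y => (norm_planeWave _ y).le)
  exact integral_add (h hf) (h hg)

theorem fourierInv_sum {ι : Type*} (S : Finset ι) {f : ι → R3 → ℂ}
    (hf : ∀ i ∈ S, Integrable (f i)) (x : R3) :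
    𝓕⁻ (fun ξ => ∑ i ∈ S, f i ξ) x = ∑ i ∈ S, 𝓕⁻ (f i) x := by
  simp only [Real.fourierInv_eq_fourier_neg, fourier_eq_integral_planeWave, Finset.sum_mul]
  exact integral_finsetSum _ fun i hi => (hf i hi).mul_bdd (c := 1)
    (contDiff_planeWave _).continuous.aestronglyMeasurable
    (.of_forall fun y => (norm_planeWave _ y).le)

/-- `e^{-(ε+it)m}`. -/
def dampedSymbol (ε t : ℝ) (ξ : R3) : ℂ := Complex.exp (-((ε : ℂ) + Complex.I * t) * freq ξ)

theorem greenSymbol_add (ε t s : ℝ) (ξ : R3) :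
    greenSymbol (((ε + s : ℝ) : ℂ) + Complex.I * t) ξ
      = dampedSymbol ε t ξ / freq ξ * (Real.exp (-(s * freq ξ)) : ℝ) := by
  unfold greenSymbol dampedSymbol
  rw [div_mul_eq_mul_div, Complex.ofReal_exp, ← Complex.exp_add]
  congr 2
  push_cast
  ring

theorem norm_greenSymbol_add_le {ε t s : ℝ} (hs : 0 ≤ s) (ξ : R3) :
    ‖greenSymbol (((ε + s : ℝ) : ℂ) + Complex.I * t) ξ‖ ≤ Real.exp (-(ε * freq ξ)) / freq ξ := by
  rw [norm_greenSymbol]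
  have := freq_nonneg ξ
  gcongr
  simp
  linarith

theorem measurable_greenSymbol_add (ε t : ℝ) :
    Measurable fun p : ℝ × R3 => greenSymbol (((ε + p.1 : ℝ) : ℂ) + Complex.I * t) p.2 := by
  have h : Measurable fun p : ℝ × R3 => ((((ε + p.1 : ℝ) : ℂ) + Complex.I * t, p.2) : ℂ × R3) := by
    fun_prop
  exact measurable_greenSymbol.comp h

/-- The multiplier of `∂ⱼΔu` in the decomposition of `e^{-(ε+it)m}`. -/
def gradMultiplier (ε t : ℝ) (j : Fin 3) (ξ : R3) : ℂ :=
  ∫ s in Set.Ioc (0 : ℝ) 1, (cutoff s : ℂ) *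
    (2 * Real.pi * Complex.I * ξ j * greenSymbol (((ε + s : ℝ) : ℂ) + Complex.I * t) ξ)

/-- The multiplier of `u` in the decomposition of `e^{-(ε+it)m}`. -/
def lowMultiplier (ε t : ℝ) (ξ : R3) : ℂ :=
  ∫ s in Set.Ioc (0 : ℝ) 1, (cutoffDeriv s : ℂ) *
    greenSymbol (((ε + s : ℝ) : ℂ) + Complex.I * t) ξ

theorem gradMultiplier_eq (ε t : ℝ) (j : Fin 3) (ξ : R3) :
    gradMultiplier ε t j ξ = 2 * Real.pi * Complex.I * ξ j * (dampedSymbol ε t ξ / freq ξ) *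
      (∫ s in Set.Ioc (0 : ℝ) 1, cutoff s * Real.exp (-(s * freq ξ)) : ℝ) := by
  rw [← integral_complex_ofReal, ← integral_const_mul]
  refine integral_congr_ae (.of_forall fun s => ?_)
  simp only [greenSymbol_add]
  push_cast
  ring

theorem lowMultiplier_eq (ε t : ℝ) (ξ : R3) :
    lowMultiplier ε t ξ = dampedSymbol ε t ξ / freq ξ *
      (∫ s in Set.Ioc (0 : ℝ) 1, cutoffDeriv s * Real.exp (-(s * freq ξ)) : ℝ) := by
  rw [← integral_complex_ofReal, ← integral_const_mul]
  refine integral_congr_ae (.of_forall fun s => ?_)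
  simp only [greenSymbol_add]
  push_cast
  ring

/-- The left side is multiplied by the partition of `1` in `integral_cutoff`, with `m³` written as
`m⁻¹ m⁴`. The division by `m` excludes only the null set `ξ = 0`. -/
theorem dampedSymbol_mul_fourier {u : R3 → ℂ} {v : Fin 3 → R3 → ℂ}
    (hv : ∀ j ξ, 𝓕 (v j) ξ = -((freq ξ : ℂ) ^ 2) * (2 * Real.pi * Complex.I * ξ j) * 𝓕 u ξ)
    (ε t : ℝ) {ξ : R3} (hξ : ξ ≠ 0) :
    dampedSymbol ε t ξ * 𝓕 u ξ
      = (∑ j, gradMultiplier ε t j ξ * 𝓕 (v j) ξ) + lowMultiplier ε t ξ * 𝓕 u ξ := by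
  have hm := freq_pos hξ
  have hm' : (freq ξ : ℂ) ≠ 0 := by exact_mod_cast hm.ne'
  have hid := integral_cutoff hm
  set I1 := ∫ s in Set.Ioc (0 : ℝ) 1, cutoff s * Real.exp (-(s * freq ξ)) with hI1
  set I2 := ∫ s in Set.Ioc (0 : ℝ) 1, cutoffDeriv s * Real.exp (-(s * freq ξ)) with hI2
  have hsum : ∑ j, gradMultiplier ε t j ξ * 𝓕 (v j) ξ
      = dampedSymbol ε t ξ / freq ξ * I1 * ((freq ξ : ℂ) ^ 4 * 𝓕 u ξ) := by
    rw [← sum_mul_fourier_grad_laplacian hv, Finset.mul_sum]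
    refine Finset.sum_congr rfl fun j _ => ?_
    rw [gradMultiplier_eq]
    ring
  have hidC : (freq ξ : ℂ) ^ 3 * I1 + I2 / freq ξ = 1 := by exact_mod_cast hid
  rw [hsum, lowMultiplier_eq, ← hI2]
  calc dampedSymbol ε t ξ * 𝓕 u ξ
      = dampedSymbol ε t ξ * 𝓕 u ξ * ((freq ξ : ℂ) ^ 3 * I1 + I2 / freq ξ) := by
        rw [hidC, mul_one]
    _ = _ := by field_simp

/-- Damping `ε > 0` supplies the integrable majorant that Fubini needs; the kernel bounds use only
`s ≤ ε + s`, so `ε` is absent from the result. -/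
theorem gradMultiplier_bound {ε : ℝ} (hε : 0 < ε) {t : ℝ} (ht : 0 ≤ t) (j : Fin 3) :
    Integrable (gradMultiplier ε t j) ∧
      ∀ x, ‖𝓕⁻ (gradMultiplier ε t j) x‖ ≤ 4 * (√(1 + t ^ 2))⁻¹ := by
  have hmeas : Measurable (Function.uncurry fun (s : ℝ) (ξ : R3) => (cutoff s : ℂ) *
      (2 * Real.pi * Complex.I * ξ j * greenSymbol (((ε + s : ℝ) : ℂ) + Complex.I * t) ξ)) := by
    have h1 : Measurable fun p : ℝ × R3 => (cutoff p.1 : ℂ) :=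
      Complex.measurable_ofReal.comp (continuous_cutoff.measurable.comp measurable_fst)
    have h2 : Measurable fun p : ℝ × R3 => (2 * Real.pi * Complex.I * p.2 j : ℂ) := by fun_prop
    exact h1.mul (h2.mul (measurable_greenSymbol_add ε t))
  have hbd : ∀ s ∈ Set.Ioc (0 : ℝ) 1, ∀ ξ : R3, ‖(cutoff s : ℂ) *
      (2 * Real.pi * Complex.I * ξ j * greenSymbol (((ε + s : ℝ) : ℂ) + Complex.I * t) ξ)‖
      ≤ Real.exp (-(ε * freq ξ)) := fun s hs ξ => by
    rw [norm_mul, norm_mul, Complex.norm_real]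
    have h1 : |cutoff s| ≤ 1 := (abs_cutoff_le hs).trans (pow_le_one₀ hs.1.le hs.2)
    have h2 := norm_coord_le_freq ξ j
    have h3 := norm_greenSymbol_add_le (ε := ε) (t := t) hs.1.le ξ
    have h0 := freq_nonneg ξ
    calc _ ≤ 1 * (freq ξ * (Real.exp (-(ε * freq ξ)) / freq ξ)) := by gcongr; exact h1
      _ ≤ _ := by
        rw [one_mul]
        rcases h0.eq_or_lt with h | h
        · rw [← h]; simp
        · rw [mul_div_cancel₀ _ h.ne']
  obtain ⟨h1, h2⟩ := fourierInv_average hmeas (integrable_exp_freq hε) hbd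
  refine ⟨h1, fun x => ?_⟩
  rw [show 𝓕⁻ (gradMultiplier ε t j) x = _ from h2 x]
  refine le_trans (norm_integral_le_of_norm_le (g := fun s => ‖x‖ / (s ^ 2 + (‖x‖ + t) ^ 2)) ?_
    ((ae_restrict_mem measurableSet_Ioc).mono fun s hs => ?_))
    (integral_div_sq_add_sq_le (norm_nonneg x) ht)
  · rcases (norm_nonneg x).eq_or_lt with h | h
    · rw [← h]; simp
    · exact (continuous_const.div (by fun_prop) fun s => by positivity).integrableOn_Ioc
  · rw [fourierInv_const_mul, norm_mul, Complex.norm_real]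
    have hs0 := hs.1
    calc _ ≤ s ^ 2 * (‖x‖ / (s ^ 2 * (s ^ 2 + (‖x‖ + t) ^ 2))) := by
          gcongr
          · exact abs_cutoff_le hs
          · exact norm_fourierInv_deriv_greenSymbol_le hs0 (by linarith) j x
      _ = _ := by field_simp

/-- No derivative falls on the kernel here: the weight `s²` against `1/(s√(s² + t²))` is bounded
pointwise in `s`. -/
theorem lowMultiplier_bound {ε : ℝ} (hε : 0 < ε) {t : ℝ} (ht : 0 ≤ t) :
    Integrable (lowMultiplier ε t) ∧
      ∀ x, ‖𝓕⁻ (lowMultiplier ε t) x‖ ≤ 100608 * (√(1 + t ^ 2))⁻¹ := by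
  have hmeas : Measurable (Function.uncurry fun (s : ℝ) (ξ : R3) => (cutoffDeriv s : ℂ) *
      greenSymbol (((ε + s : ℝ) : ℂ) + Complex.I * t) ξ) := by
    have h1 : Measurable fun p : ℝ × R3 => (cutoffDeriv p.1 : ℂ) :=
      Complex.measurable_ofReal.comp (continuous_cutoffDeriv.measurable.comp measurable_fst)
    exact h1.mul (measurable_greenSymbol_add ε t)
  have hbd : ∀ s ∈ Set.Ioc (0 : ℝ) 1, ∀ ξ : R3, ‖(cutoffDeriv s : ℂ) *
      greenSymbol (((ε + s : ℝ) : ℂ) + Complex.I * t) ξ‖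
      ≤ 100608 * (Real.exp (-(ε * freq ξ)) / freq ξ) := fun s hs ξ => by
    rw [norm_mul, Complex.norm_real]
    have h1 : |cutoffDeriv s| ≤ 100608 := (abs_cutoffDeriv_le hs).trans
      (mul_le_of_le_one_right (by norm_num) (pow_le_one₀ hs.1.le hs.2))
    have h3 := norm_greenSymbol_add_le (ε := ε) (t := t) hs.1.le ξ
    gcongr
    exact h1
  obtain ⟨h1, h2⟩ := fourierInv_average hmeas ((integrable_exp_freq_div hε).const_mul 100608) hbd
  refine ⟨h1, fun x => ?_⟩
  rw [show 𝓕⁻ (lowMultiplier ε t) x = _ from h2 x]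
  refine (norm_setIntegral_le_of_norm_le_const (C := 100608 * (√(1 + t ^ 2))⁻¹) (by simp)
    fun s hs => ?_).trans_eq (by simp)
  rw [fourierInv_const_mul, norm_mul, Complex.norm_real]
  have hs0 := hs.1
  calc _ ≤ 100608 * s ^ 2 * (1 / (s * √(s ^ 2 + t ^ 2))) := by
        gcongr
        · exact abs_cutoffDeriv_le hs
        · exact norm_fourierInv_greenSymbol_le hs0 (by linarith) ht x
    _ = 100608 * (s / √(s ^ 2 + t ^ 2)) := by field_simp
    _ ≤ _ := by
        gcongr
        exact div_sqrt_le hs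

theorem integrable_mul_fourier {κ u : R3 → ℂ} (hκ : Integrable κ) (hu : Integrable u) :
    Integrable fun ξ => κ ξ * 𝓕 u ξ :=
  hκ.mul_bdd (continuous_fourier hu).aestronglyMeasurable (.of_forall norm_fourier_le)

/-- The pointwise dispersive bound for the damped propagator, uniform in the damping. -/
theorem norm_fourierInv_damped_le {u : R3 → ℂ} (hu : Integrable u) {v : Fin 3 → R3 → ℂ}
    (hv0 : ∀ j, Integrable (v j))
    (hv : ∀ j ξ, 𝓕 (v j) ξ = -((freq ξ : ℂ) ^ 2) * (2 * Real.pi * Complex.I * ξ j) * 𝓕 u ξ)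
    {ε : ℝ} (hε : 0 < ε) {t : ℝ} (ht : 0 ≤ t) (x : R3) :
    ‖𝓕⁻ (fun ξ => dampedSymbol ε t ξ * 𝓕 u ξ) x‖
      ≤ (4 * ∑ j, (∫ y, ‖v j y‖) + 100608 * ∫ y, ‖u y‖) * (√(1 + t ^ 2))⁻¹ := by
  have hg := gradMultiplier_bound hε ht
  have hl := lowMultiplier_bound hε ht
  have h1 : ∀ᵐ ξ : R3, dampedSymbol ε t ξ * 𝓕 u ξ
      = (∑ j, gradMultiplier ε t j ξ * 𝓕 (v j) ξ) + lowMultiplier ε t ξ * 𝓕 u ξ :=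
    (Measure.ae_ne volume 0).mono fun ξ hξ => dampedSymbol_mul_fourier hv ε t hξ
  have hi : ∀ j, Integrable fun ξ => gradMultiplier ε t j ξ * 𝓕 (v j) ξ :=
    fun j => integrable_mul_fourier (hg j).1 (hv0 j)
  rw [Real.fourierInv_congr_ae h1, fourierInv_add (integrable_finsetSum _ fun j _ => hi j)
    (integrable_mul_fourier hl.1 hu), fourierInv_sum _ fun j _ => hi j]
  have h2 := norm_fourierInv_mul_fourier_le hu hl.1 hl.2 x
  have h3 : ‖∑ j, 𝓕⁻ (fun ξ => gradMultiplier ε t j ξ * 𝓕 (v j) ξ) x‖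
      ≤ ∑ j, 4 * (√(1 + t ^ 2))⁻¹ * ∫ y, ‖v j y‖ :=
    norm_sum_le_of_le _ fun j _ => norm_fourierInv_mul_fourier_le (hv0 j) (hg j).1 (hg j).2 x
  refine (norm_add_le _ _).trans ((add_le_add h3 h2).trans_eq ?_)
  rw [← Finset.mul_sum]
  ring

/-! ### Removing the damping. -/

theorem dampedSymbol_zero (t : ℝ) (ξ : R3) : dampedSymbol 0 t ξ = halfWaveSymbol t ξ := by
  unfold dampedSymbol halfWaveSymbol freq
  congr 1
  push_cast
  ring

theorem norm_dampedSymbol (ε t : ℝ) (ξ : R3) :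
    ‖dampedSymbol ε t ξ‖ = Real.exp (-(ε * freq ξ)) := by
  rw [dampedSymbol, norm_cexp_neg_mul_ofReal]
  simp

theorem norm_dampedSymbol_le {ε : ℝ} (hε : 0 ≤ ε) (t : ℝ) (ξ : R3) :
    ‖dampedSymbol ε t ξ‖ ≤ 1 := by
  rw [norm_dampedSymbol, Real.exp_le_one_iff]
  have := freq_nonneg ξ
  have := mul_nonneg hε this
  linarith

theorem continuous_dampedSymbol (ε t : ℝ) : Continuous (dampedSymbol ε t) := by
  have := continuous_freq
  unfold dampedSymbol
  fun_prop

theorem integrable_dampedSymbol {ε : ℝ} (hε : 0 < ε) (t : ℝ) : Integrable (dampedSymbol ε t) :=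
  (integrable_exp_freq hε).mono' (continuous_dampedSymbol ε t).aestronglyMeasurable
    (.of_forall fun ξ => (norm_dampedSymbol ε t ξ).le)

theorem memLp_dampedSymbol_mul {ε : ℝ} (hε : 0 ≤ ε) (t : ℝ) {F : R3 → ℂ}
    (hF : MemLp F 2 volume) : MemLp (fun ξ => dampedSymbol ε t ξ * F ξ) 2 volume := by
  refine hF.of_le ((continuous_dampedSymbol ε t).aestronglyMeasurable.mul hF.1)
    (.of_forall fun ξ => ?_)
  rw [norm_mul]
  exact mul_le_of_le_one_left (norm_nonneg _) (norm_dampedSymbol_le hε t ξ)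

theorem tendsto_eLpNorm_two_of_dominated {f : ℕ → R3 → ℂ} {g : R3 → ℂ} {b : R3 → ℂ}
    (hf : ∀ n, AEStronglyMeasurable (f n) volume) (hg : AEStronglyMeasurable g volume)
    (hb : MemLp b 2 volume) (hfb : ∀ n x, ‖f n x - g x‖ ≤ ‖b x‖)
    (hlim : ∀ x, Tendsto (fun n => f n x) atTop (𝓝 (g x))) :
    Tendsto (fun n => eLpNorm (f n - g) 2 volume) atTop (𝓝 0) := by
  have h2 : ∀ h : R3 → ℂ, eLpNorm h 2 volume = (∫⁻ x, ‖h x‖ₑ ^ 2) ^ (1 / 2 : ℝ) := fun h => by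
    rw [eLpNorm_eq_lintegral_rpow_enorm_toReal two_ne_zero ENNReal.ofNat_ne_top]
    simp
  have hfin : ∫⁻ x, ‖b x‖ₑ ^ 2 ≠ ⊤ := fun h => by
    have := hb.2
    rw [h2, h] at this
    simp at this
  have h0 : Tendsto (fun n => ∫⁻ x, ‖(f n - g) x‖ₑ ^ 2) atTop (𝓝 (∫⁻ _ : R3, 0)) := by
    refine tendsto_lintegral_of_dominated_convergence' (fun x => ‖b x‖ₑ ^ 2)
      (fun n => ((hf n).sub hg).enorm.pow_const 2) (fun n => .of_forall fun x => ?_) hfin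
      (.of_forall fun x => ?_)
    · have := enorm_le_iff_norm_le.2 (hfb n x)
      exact pow_le_pow_left₀ zero_le this 2
    · have h3 : Tendsto (fun n => (f n - g) x) atTop (𝓝 0) := by
        simpa using (hlim x).sub_const (g x)
      have h4 : Tendsto (fun n => ‖(f n - g) x‖ₑ) atTop (𝓝 0) := by simpa using h3.enorm
      simpa using ENNReal.Tendsto.pow (n := 2) h4
  simp only [h2]
  have := (ENNReal.continuous_rpow_const (y := 1 / 2)).tendsto (∫⁻ _ : R3, 0) |>.comp h0
  simpa [Function.comp_def] using this

theorem halfWave_toLp {u : R3 → ℂ} (hu : Integrable u) (hu2 : MemLp u 2 volume)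
    (hF : MemLp (𝓕 u) 2 volume) (t : ℝ) :
    halfWave t (hu2.toLp u) = 𝓕⁻ ((memLp_dampedSymbol_mul le_rfl t hF).toLp _) := by
  unfold halfWave
  congr 1
  rw [MemLp.toLp_eq_toLp_iff, fourier_toLp_eq hu hu2 hF]
  filter_upwards [hF.coeFn_toLp] with ξ hξ
  rw [hξ, dampedSymbol_zero]

/-- The dispersive estimate for the half-wave group with data in `W^{3,1}(ℝ³)`. -/
theorem exists_ae_norm_halfWave_le {u : R3 → ℂ} (h : MemW1 3 u) (hu2 : MemLp u 2 volume) :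
    ∃ M : ℝ, 0 ≤ M ∧ ∀ t : ℝ, 0 ≤ t →
      ∀ᵐ x, ‖halfWave t (hu2.toLp u) x‖ ≤ M * (√(1 + t ^ 2))⁻¹ := by
  obtain ⟨hu, v, hv0, hv⟩ := exists_grad_laplacian h
  have hF := memLp_fourier_of_memW1 h
  refine ⟨4 * ∑ j, (∫ y, ‖v j y‖) + 100608 * ∫ y, ‖u y‖, ?_, fun t ht => ?_⟩
  · have h1 : 0 ≤ ∑ j, ∫ y, ‖v j y‖ :=
      Finset.sum_nonneg fun _ _ => integral_nonneg fun _ => norm_nonneg _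
    have h2 : 0 ≤ ∫ y, ‖u y‖ := integral_nonneg fun _ => norm_nonneg _
    positivity
  set M : ℝ := 4 * ∑ j, (∫ y, ‖v j y‖) + 100608 * ∫ y, ‖u y‖
  set ε : ℕ → ℝ := fun n => 1 / ((n : ℝ) + 1) with hε
  have hε0 : ∀ n, 0 < ε n := fun n => by positivity
  have hεlim : Tendsto ε atTop (𝓝 0) := tendsto_one_div_add_atTop_nhds_zero_nat
  have hm : ∀ n, MemLp (fun ξ => dampedSymbol (ε n) t ξ * 𝓕 u ξ) 2 volume :=
    fun n => memLp_dampedSymbol_mul (hε0 n).le t hF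
  have hm0 := memLp_dampedSymbol_mul le_rfl t hF
  -- Dominated convergence on the Fourier side, with majorant `2|û|` in `L²`; continuity of `𝓕⁻` on
  -- `L²` transfers the limit.
  have hlim : Tendsto (fun n => (hm n).toLp _) atTop (𝓝 (hm0.toLp _)) := by
    rw [Lp.tendsto_Lp_iff_tendsto_eLpNorm'']
    refine tendsto_eLpNorm_two_of_dominated (b := fun ξ => 2 * 𝓕 u ξ) (fun n => (hm n).1) hm0.1
      (hF.const_mul 2) (fun n ξ => ?_) (fun ξ => ?_)
    · rw [← sub_mul, norm_mul, norm_mul]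
      gcongr
      refine (norm_sub_le _ _).trans ?_
      have h1 := norm_dampedSymbol_le (hε0 n).le t ξ
      have h2 := norm_dampedSymbol_le le_rfl t ξ
      rw [Complex.norm_ofNat]
      linarith
    · refine Tendsto.mul_const _ ?_
      have hc : Continuous fun e : ℝ => dampedSymbol e t ξ := by
        unfold dampedSymbol
        fun_prop
      exact (hc.tendsto 0).comp hεlim
  have hlim2 : Tendsto (fun n => (𝓕⁻ ((hm n).toLp _) : L2)) atTop
      (𝓝 (halfWave t (hu2.toLp u))) := by
    rw [halfWave_toLp hu hu2 hF]
    exact ((ContinuousFourierInv.continuous_fourierInv (E := L2) (F := L2)).tendsto _).comp hlim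
  -- An a.e. convergent subsequence is enough, since the pointwise bound does not depend on `n`.
  obtain ⟨ns, -, hns⟩ := (tendstoInMeasure_of_tendsto_Lp hlim2).exists_seq_tendsto_ae
  have hae : ∀ᵐ x, ∀ n, ‖(𝓕⁻ ((hm n).toLp _) : L2) x‖ ≤ M * (√(1 + t ^ 2))⁻¹ := by
    rw [ae_all_iff]
    intro n
    filter_upwards [fourierInv_toLp_ae_eq_of_integrable (hm n)
      (integrable_mul_fourier (integrable_dampedSymbol (hε0 n) t) hu)] with x hx
    rw [hx]
    exact norm_fourierInv_damped_le hu hv0 hv (hε0 n) ht x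
  filter_upwards [hns, hae] with x h1 h2
  exact le_of_tendsto h1.norm (.of_forall fun i => h2 (ns i))

/-! ### The remainder in `L²` and its modal coefficients. -/

theorem norm_convolution_re_le {w : R3 → ℝ} (hw : Integrable w) {v : R3 → ℂ} {B : ℝ}
    (hv : ∀ᵐ y, ‖v y‖ ≤ B) (x : R3) :
    ‖(w ⋆[ContinuousLinearMap.mul ℝ ℝ, volume] (fun y => (v y).re)) x‖ ≤ B * ∫ y, |w y| := by
  rw [convolution_def, ← integral_const_mul]
  refine norm_integral_le_of_norm_le (hw.abs.const_mul B) ?_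
  have h := (quasiMeasurePreserving_sub_left_of_right_invariant
    (volume : Measure R3) x).ae hv
  filter_upwards [h] with y hy
  rw [ContinuousLinearMap.mul_apply', norm_mul, mul_comm, Real.norm_eq_abs (w y)]
  gcongr
  exact (Complex.abs_re_le_norm _).trans hy

theorem aestronglyMeasurable_convolution_re {w : R3 → ℝ} (hw : AEStronglyMeasurable w volume)
    {v : R3 → ℂ} (hv : AEStronglyMeasurable v volume) : AEStronglyMeasurable
      (w ⋆[ContinuousLinearMap.mul ℝ ℝ, volume] (fun y => (v y).re)) volume := by
  have h : AEStronglyMeasurable (fun y => (v y).re) volume :=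
    Complex.continuous_re.comp_aestronglyMeasurable hv
  exact (hw.convolution_integrand (ContinuousLinearMap.mul ℝ ℝ) h).integral_prod_right'

theorem memLp_remainder {η : ℝ} (hη : 0 < η) {w : R3 → ℝ} (hw : Integrable w) (u φt : L2)
    {t B : ℝ} (hB : ∀ᵐ x, ‖halfWave t u x‖ ≤ B) :
    MemLp (remainder η w u φt t) 2 volume ∧
      eLpNorm (remainder η w u φt t) 2 volume
        ≤ ENNReal.ofReal (η * (B * ∫ y, |w y|) * ‖φt‖) := by
  have hbd : ∀ x, ‖remainder η w u φt t x‖ ≤ η * (B * ∫ y, |w y|) * ‖φt x‖ := fun x => by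
    rw [remainder, norm_mul, Complex.norm_real, norm_mul, Real.norm_of_nonneg hη.le]
    gcongr
    exact norm_convolution_re_le hw hB x
  have hm : AEStronglyMeasurable (remainder η w u φt t) volume := by
    have h := aestronglyMeasurable_convolution_re hw.1
      (Lp.aestronglyMeasurable (halfWave t u))
    exact (Complex.continuous_ofReal.comp_aestronglyMeasurable (h.const_mul η)).mul
      (Lp.aestronglyMeasurable φt)
  refine ⟨(Lp.memLp φt).of_le_mul hm (.of_forall hbd), ?_⟩
  have h0 : 0 ≤ η * (B * ∫ y, |w y|) := by
    have := (norm_nonneg _).trans (norm_convolution_re_le hw hB 0)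
    positivity
  rw [ENNReal.ofReal_mul h0, Lp.norm_def, ENNReal.ofReal_toReal (Lp.eLpNorm_ne_top φt)]
  exact eLpNorm_le_mul_eLpNorm_of_ae_le_mul (.of_forall hbd) 2

/-- Bessel's inequality; the phases enter only through the common modulus `a` of the factors `c k`.
-/
theorem eLpNorm_count_inner_le {χ : ℕ → L2} (hχ : Orthonormal ℂ χ) (R : L2) {c : ℕ → ℂ} {a : ℝ}
    (hc : ∀ k, ‖c k‖ = a) :
    eLpNorm (fun k => c k * inner ℂ (χ k) R) 2 Measure.count ≤ ENNReal.ofReal (a * ‖R‖) := by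
  have ha : 0 ≤ a := hc 0 ▸ norm_nonneg _
  rw [eLpNorm_eq_lintegral_rpow_enorm_toReal two_ne_zero ENNReal.ofNat_ne_top, lintegral_count]
  have h1 : ∀ k, ‖c k * inner ℂ (χ k) R‖ₑ ^ (2 : ℝ≥0∞).toReal
      = ENNReal.ofReal (a ^ 2 * ‖inner ℂ (χ k) R‖ ^ 2) := fun k => by
    rw [← ofReal_norm, norm_mul, hc, ← mul_pow, ENNReal.toReal_ofNat,
      ENNReal.ofReal_rpow_of_nonneg (by positivity) (by norm_num)]
    norm_num
  simp only [h1]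
  rw [← ENNReal.ofReal_tsum_of_nonneg (fun k => by positivity)
    ((hχ.inner_products_summable R).mul_left _), tsum_mul_left]
  have h2 := hχ.tsum_inner_products_le R
  calc ENNReal.ofReal (a ^ 2 * ∑' k, ‖inner ℂ (χ k) R‖ ^ 2) ^ (1 / (2 : ℝ≥0∞).toReal)
      ≤ ENNReal.ofReal ((a * ‖R‖) ^ 2) ^ (1 / (2 : ℝ≥0∞).toReal) := by
        gcongr
        rw [mul_pow]
        gcongr
    _ = ENNReal.ofReal (a * ‖R‖) := by
        rw [ENNReal.ofReal_rpow_of_nonneg (by positivity) (by positivity)]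
        congr 1
        rw [ENNReal.toReal_ofNat, ← Real.sqrt_eq_rpow, Real.sqrt_sq (by positivity)]

theorem eLpNorm_remainderMode_le (χ : HilbertBasis ℕ ℂ L2) (E : ℕ → ℝ) {η : ℝ} (hη : 0 < η)
    {w : R3 → ℝ} (hw : Integrable w) (u φt : L2) (hφ : ‖φt‖ = 1) {t B : ℝ}
    (hB : ∀ᵐ x, ‖halfWave t u x‖ ≤ B) :
    eLpNorm (fun k : ℕ => (1 / (η : ℂ) ^ 2) * remainderMode (χ k) (E k) η w u φt t) 2
      Measure.count ≤ ENNReal.ofReal (η⁻¹ * (B * ∫ y, |w y|)) := by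
  obtain ⟨hm, hle⟩ := memLp_remainder hη hw u φt hB
  have h0 : 0 ≤ B * ∫ y, |w y| := (norm_nonneg _).trans (norm_convolution_re_le hw hB 0)
  have hR : ‖hm.toLp _‖ ≤ η * (B * ∫ y, |w y|) := by
    rw [Lp.norm_toLp]
    rw [hφ, mul_one] at hle
    exact ENNReal.toReal_le_of_le_ofReal (by positivity) hle
  have hmode : ∀ k, (1 / (η : ℂ) ^ 2) * remainderMode (χ k) (E k) η w u φt t
      = ((1 / (η : ℂ) ^ 2) * Complex.exp (Complex.I * (t * E k : ℝ))) *
        inner ℂ (χ k) (hm.toLp _) := fun k => by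
    rw [remainderMode, L2.inner_def, mul_assoc]
    congr 2
    refine integral_congr_ae ?_
    filter_upwards [hm.coeFn_toLp] with x hx
    rw [hx, RCLike.inner_apply, mul_comm]
  simp only [hmode]
  refine (eLpNorm_count_inner_le χ.orthonormal (hm.toLp _) (a := (η ^ 2)⁻¹) fun k => ?_).trans ?_
  · rw [norm_mul, mul_comm Complex.I, Complex.norm_exp_ofReal_mul_I, mul_one, norm_div, norm_one,
      norm_pow, Complex.norm_real, Real.norm_of_nonneg hη.le, one_div]
  · refine ENNReal.ofReal_le_ofReal ?_
    calc (η ^ 2)⁻¹ * ‖hm.toLp _‖ ≤ (η ^ 2)⁻¹ * (η * (B * ∫ y, |w y|)) := by gcongr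
      _ = _ := by field_simp

/-! ### The time integral and the limit `η → 0⁺`. -/

theorem arsinh_div_sq {η : ℝ} (hη : 0 < η) (T : ℝ) :
    Real.arsinh (T / η ^ 2) = Real.log ((T + √(η ^ 4 + T ^ 2)) / η ^ 2) := by
  rw [Real.arsinh]
  congr 1
  have h : 1 + (T / η ^ 2) ^ 2 = (η ^ 4 + T ^ 2) / (η ^ 2) ^ 2 := by field_simp
  rw [h, Real.sqrt_div (by positivity), Real.sqrt_sq (by positivity)]
  ring

theorem lintegral_inv_sqrt {η : ℝ} (hη : 0 < η) {T : ℝ} (hT : 0 ≤ T) {c : ℝ} (hc : 0 ≤ c) :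
    ∫⁻ s in Set.Icc 0 T, ENNReal.ofReal (c * (√(1 + (s / η ^ 2) ^ 2))⁻¹)
      = ENNReal.ofReal (c * (η ^ 2 * Real.log ((T + √(η ^ 4 + T ^ 2)) / η ^ 2))) := by
  have hcont : Continuous fun s : ℝ => c * (√(1 + (s / η ^ 2) ^ 2))⁻¹ :=
    continuous_const.mul ((by fun_prop : Continuous fun s : ℝ => √(1 + (s / η ^ 2) ^ 2)).inv₀
      fun s => (Real.sqrt_pos.2 (by positivity)).ne')
  rw [← ofReal_integral_eq_lintegral_ofReal hcont.integrableOn_Icc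
    (.of_forall fun s => by positivity), integral_Icc_eq_integral_Ioc,
    ← intervalIntegral.integral_of_le hT]
  have hder : ∀ s : ℝ, HasDerivAt (fun s => c * (η ^ 2 * Real.arsinh (s / η ^ 2)))
      (c * (√(1 + (s / η ^ 2) ^ 2))⁻¹) s := fun s => by
    have := ((((hasDerivAt_id s).div_const (η ^ 2)).arsinh).const_mul (η ^ 2)).const_mul c
    refine this.congr_deriv ?_
    simp only [id, smul_eq_mul]
    field_simp
  rw [intervalIntegral.integral_eq_sub_of_hasDerivAt (fun s _ => hder s)
    (hcont.intervalIntegrable 0 T), arsinh_div_sq hη]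
  simp

theorem scaledRemainderIntegral_le (χ : HilbertBasis ℕ ℂ L2) (E : ℕ → ℝ) {η : ℝ} (hη : 0 < η)
    {w : R3 → ℝ} (hw : Integrable w) (u : L2) {φ : ℝ → L2} (hφ : ∀ t, 0 ≤ t → ‖φ t‖ = 1)
    {M : ℝ} (hM0 : 0 ≤ M)
    (hM : ∀ t, 0 ≤ t → ∀ᵐ x, ‖halfWave t u x‖ ≤ M * (√(1 + t ^ 2))⁻¹) {T : ℝ} (hT : 0 ≤ T) :
    scaledRemainderIntegral χ E η w u φ T ≤ ENNReal.ofReal ((M * ∫ x, |w x|) * η *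
      Real.log ((T + √(η ^ 4 + T ^ 2)) / η ^ 2)) := by
  have hw0 : 0 ≤ ∫ x, |w x| := integral_nonneg fun _ => abs_nonneg _
  calc scaledRemainderIntegral χ E η w u φ T
      ≤ ∫⁻ s in Set.Icc 0 T,
        ENNReal.ofReal ((η⁻¹ * (M * ∫ x, |w x|)) * (√(1 + (s / η ^ 2) ^ 2))⁻¹) := by
        refine setLIntegral_mono' measurableSet_Icc fun s hs => ?_
        have hs0 : 0 ≤ s / η ^ 2 := div_nonneg hs.1 (by positivity)
        refine (eLpNorm_remainderMode_le χ E hη hw u _ (hφ _ hs0) (hM _ hs0)).trans_eq ?_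
        congr 1
        ring
    _ = _ := by
        -- The `η²` of the rescaled time integral meets the `η⁻¹` of the mode bound.
        rw [lintegral_inv_sqrt hη hT (by positivity)]
        congr 1
        field_simp

theorem tendsto_mul_log_zero (c : ℝ) {T : ℝ} (hT : 0 < T) :
    Tendsto (fun η : ℝ => c * η * Real.log ((T + √(η ^ 4 + T ^ 2)) / η ^ 2)) (𝓝[>] 0) (𝓝 0) := by
  have hpos : ∀ η : ℝ, T + √(η ^ 4 + T ^ 2) ≠ 0 := fun η => by positivity
  -- Once the logarithm is split, the only singular term is `η log η`, which is continuous on all of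
  -- `ℝ` with value `0` at `0`; so the limit is an evaluation.
  have hcont : Continuous fun η : ℝ =>
      c * (η * Real.log (T + √(η ^ 4 + T ^ 2)) - 2 * (η * Real.log η)) := by
    have h1 : Continuous fun η : ℝ => Real.log (T + √(η ^ 4 + T ^ 2)) :=
      Continuous.log (by fun_prop) hpos
    have h2 := Real.continuous_mul_log
    fun_prop
  have h := (hcont.tendsto 0).mono_left (nhdsWithin_le_nhds (s := Set.Ioi 0))
  simp only [zero_mul, mul_zero, sub_zero] at h
  refine h.congr' ?_
  filter_upwards [self_mem_nhdsWithin] with η hη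
  have hη : 0 < η := hη
  rw [Real.log_div (hpos η) (by positivity), Real.log_pow]
  push_cast
  ring

end InitialField

end

theorem mainTheorem9 (u₀ : InitialField.R3 → ℂ) (hu₀ : InitialField.MemW1 3 u₀) :
    ∃ hu₂ : MemLp u₀ 2 volume, ∃ C₀ : ℝ, 0 ≤ C₀ ∧
      (∀ t : ℝ, 0 ≤ t →
        eLpNorm (InitialField.halfWave t (hu₂.toLp u₀)) ∞ volume
          ≤ ENNReal.ofReal (C₀ * (Real.sqrt (1 + t ^ 2))⁻¹)) ∧
      ∀ (V : InitialField.R3 → ℝ) (E : ℕ → ℝ) (χ : HilbertBasis ℕ ℂ InitialField.L2),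
        InitialField.IsConfining V → InitialField.IsEigenbasis V E χ →
      ∀ w : InitialField.R3 → ℝ, Integrable w volume →
      ∀ φ : ℝ → ℝ → InitialField.L2, (∀ η : ℝ, 0 < η → ∀ t : ℝ, 0 ≤ t → ‖φ η t‖ = 1) →
        (∀ η : ℝ, 0 < η → ∀ t : ℝ, 0 ≤ t →
          MemLp (InitialField.remainder η w (hu₂.toLp u₀) (φ η t) t) 2 volume) ∧
        ∀ T : ℝ, 0 < T →
          (∀ η : ℝ, 0 < η →
            InitialField.scaledRemainderIntegral χ E η w (hu₂.toLp u₀) (φ η) T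
              ≤ ENNReal.ofReal ((C₀ * ∫ x, |w x|) * η *
                  Real.log ((T + Real.sqrt (η ^ 4 + T ^ 2)) / η ^ 2))) ∧
          Tendsto (fun η : ℝ => (C₀ * ∫ x, |w x|) * η *
              Real.log ((T + Real.sqrt (η ^ 4 + T ^ 2)) / η ^ 2)) (𝓝[>] 0) (𝓝 0) ∧
          Tendsto (fun η : ℝ =>
              InitialField.scaledRemainderIntegral χ E η w (hu₂.toLp u₀) (φ η) T)
            (𝓝[>] 0) (𝓝 0) := by
  have hu₂ : MemLp u₀ 2 volume :=
    InitialField.memLp_two_of_fourier hu₀.1 (InitialField.memLp_fourier_of_memW1 hu₀)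
  obtain ⟨M, hM0, hM⟩ := InitialField.exists_ae_norm_halfWave_le hu₀ hu₂
  refine ⟨hu₂, M, hM0, fun t ht => ?_, fun V E χ _ _ w hw φ hφ => ⟨fun η hη t ht =>
    (InitialField.memLp_remainder hη hw _ _ (hM t ht)).1, fun T hT => ?_⟩⟩
  · rw [eLpNorm_exponent_top]
    exact eLpNormEssSup_le_of_ae_bound (hM t ht)
  have hle : ∀ η : ℝ, 0 < η → InitialField.scaledRemainderIntegral χ E η w (hu₂.toLp u₀) (φ η) T
      ≤ ENNReal.ofReal ((M * ∫ x, |w x|) * η *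
        Real.log ((T + Real.sqrt (η ^ 4 + T ^ 2)) / η ^ 2)) := fun η hη =>
    InitialField.scaledRemainderIntegral_le χ E hη hw _ (hφ η hη) hM0 hM hT.le
  have hlim := InitialField.tendsto_mul_log_zero (M * ∫ x, |w x|) hT
  refine ⟨hle, hlim, ?_⟩
  refine tendsto_of_tendsto_of_tendsto_of_le_of_le' tendsto_const_nhds
    (ENNReal.ofReal_zero ▸ ENNReal.tendsto_ofReal hlim) (.of_forall fun _ => zero_le) ?_
  filter_upwards [self_mem_nhdsWithin] with η hη
  exact hle η hη
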